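/- **Setting.** Let $\varphi$ be the standard normal density. For a probability measure $H$ on $\mathbb R$ put $f_H(x)=\int\varphi(x-\mu)\,dH(\mu)$ and $L(H)=\int\psi\,dH$, where $\psi$ is a fixed function that is integrable with respect to every $H\in\mathcal G$. Here $\mathcal G$ is a convex set of probability measures on $\mathbb R$ with $\sup_{H\in\mathcal G}|L(H)|<\infty$. Let $G\in\mathcal G$, let $\tilde X_1,\tilde X_2,\dots,X_1,X_2,\dots$ be i.i.d. with density $f_G$, and fix $M>0$ and $\alpha\in(0,1)$. Put $$\|h\|_{\infty,M}=\max\Big\{\sup_{|x|\le M}|h(x)|,\ \Big|\int_{-\infty}^{-M}h\Big|,\ \Big|\int_M^\infty h\Big|\Big\}.$$ **Procedure.** For each $m$, the first fold $\tilde X_1,\dots,\tilde X_m$ is used to choose an integrable function $\bar f_m$ on $\mathbb R$ (a pilot estimate of $f_G$) and numbers $c_m\ge 0$, $\delta_m>0$, $\Gamma_m$. Let $$\mathcal G_m=\{H\in\mathcal G:\|f_H-\bar f_m\|_{\infty,M}\le c_m\},$$ and let $\omega_m(\delta)$ be the supremum of $L(G_1)-L(G_{-1})$ over $G_1,G_{-1}\in\mathcal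 G_m$ with $$\frac{\big(\int_{-\infty}^{-M}(f_{G_1}-f_{G_{-1}})\big)^2}{\int_{-\infty}^{-M}\bar f_m}+\int_{-M}^{M}\frac{(f_{G_1}-f_{G_{-1}})^2}{\bar f_m}\,dx+\frac{\big(\int_{M}^{\infty}(f_{G_1}-f_{G_{-1}})\big)^2}{\int_M^\infty\bar f_m}\le\delta^2 .$$ Let $(Q_0,Q)$, depending (measurably) on the first fold only, minimize $$\sup_{H\in\mathcal G_m}\Big(Q_0+\int Q f_H\,dx-L(H)\Big)^2$$ over $Q_0\in\mathbb R$ and measurable $Q$ such that $Q$ is constant on $(-\infty,-M]$, constant on $[M,\infty)$ (possibly with a different value), and $\frac1m\int Q^2\bar f_m\,dx\le\Gamma_m$ (if there is no minimizer, $(Q_0,Q)$ is arbitrary). Let $\hat B\ge0$ be the square root of the worst-case squared bias attained by $(Q_0,Q)$, and set $$\hat L=Q_0+\frac1m\sum_{i=1}^mQ(X_i),\qquad \hat V=\frac1{m(m-1)}\Big[\sum_{i=1}^mQ(X_i)^2-\frac1m\Big(\sum_{i=1}^mQ(X_i)\Big)^2\Big],$$ $$\mathcal I_\alpha=\hat L\pm\hat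 t_\alpha(\hat B,\hat V),\qquad \hat t_\alpha(B,V)=\inf\{t:\ \mathbb P(|b+V^{1/2}Z|>t)<\alpha\ \text{ for all }|b|\le B\},\quad Z\sim N(0,1).$$ **Statement.** Assume that, as $m\to\infty$: * $\mathbb P_G(\|f_G-\bar f_m\|_{\infty,M}\le c_m)\to1$ and $c_m\to0$ in probability; * $\Gamma_m=m^{-1}\omega_m'(\delta_m)^2$, where $\omega_m'(\delta_m)$ is an element of the superdifferential at $\delta_m$ of $\omega_m$ on $(0,\infty)$ (required whenever that superdifferential is non-empty), and $c_m^2/(m\delta_m^2)\to0$ in probability; * with probability tending to one, the supremum defining $\omega_m(\delta_m)$ is attained. Then $$\liminf_{m\to\infty}\mathbb P_G\big(L(G)\in\mathcal I_\alpha\big)\ \ge\ 1-\alpha .$$ -/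

import Mathlib

open MeasureTheory ProbabilityTheory Filter Topology
open scoped ENNReal NNReal

namespace BiasAware

noncomputable section

/-- The marginal density `f_G = φ ⋆ dG` of `X` when `μ ∼ G` and `X ∣ μ ∼ N(μ, 1)`. -/
def marginalDensity (G : Measure ℝ) (x : ℝ) : ℝ :=
  ∫ u, gaussianPDFReal 0 1 (x - u) ∂G

/-- The marginal law of `X`, i.e. the law with Lebesgue density `f_G`. -/
def marginal (G : Measure ℝ) : Measure ℝ :=
  volume.withDensity fun x => ENNReal.ofReal (marginalDensity G x)

/-- The linear functional `L(G) = ∫ ψ dG`. -/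
def linFun (ψ : ℝ → ℝ) (G : Measure ℝ) : ℝ := ∫ u, ψ u ∂G

/-- The norm `‖h‖_{∞,M}`: the maximum of the supremum of `|h|` on `[-M, M]` and of the absolute
values of the integrals of `h` over the two tails. -/
def bandNorm (M : ℝ) (h : ℝ → ℝ) : ℝ≥0∞ :=
  max (⨆ x ∈ Set.Icc (-M) M, ENNReal.ofReal |h x|)
    (max (ENNReal.ofReal |∫ x in Set.Iic (-M), h x|) (ENNReal.ofReal |∫ x in Set.Ici M, h x|))

/-- The localization `𝒢_m` of the class `𝒢`: the members of `𝒢` whose marginal density lies within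
distance `c` of the pilot estimate `fbar`. -/
def localization (𝒢 : Set (Measure ℝ)) (M : ℝ) (fbar : ℝ → ℝ) (c : ℝ≥0) : Set (Measure ℝ) :=
  {H | H ∈ 𝒢 ∧ bandNorm M (fun x => marginalDensity H x - fbar x) ≤ (c : ℝ≥0∞)}

/-- The weighted squared distance between `f_{G₁}` and `f_{G₂}` in the modulus problem. -/
def weightedSqDist (M : ℝ) (fbar : ℝ → ℝ) (G₁ G₂ : Measure ℝ) : ℝ :=
  (∫ x in Set.Iic (-M), (marginalDensity G₁ x - marginalDensity G₂ x)) ^ 2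
      / (∫ x in Set.Iic (-M), fbar x)
    + (∫ x in Set.Icc (-M) M, (marginalDensity G₁ x - marginalDensity G₂ x) ^ 2 / fbar x)
    + (∫ x in Set.Ici M, (marginalDensity G₁ x - marginalDensity G₂ x)) ^ 2
      / (∫ x in Set.Ici M, fbar x)

/-- `(G₁, G₂)` satisfies the constraints of the modulus problem at `δ` over the class `𝒢m`
(the integral over `[-M, M]` is required to be finite). -/
def ModulusFeasible (𝒢m : Set (Measure ℝ)) (M : ℝ) (fbar : ℝ → ℝ) (δ : ℝ)
    (G₁ G₂ : Measure ℝ) : Prop :=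
  G₁ ∈ 𝒢m ∧ G₂ ∈ 𝒢m ∧
    IntegrableOn (fun x => (marginalDensity G₁ x - marginalDensity G₂ x) ^ 2 / fbar x)
      (Set.Icc (-M) M) ∧
    weightedSqDist M fbar G₁ G₂ ≤ δ ^ 2

/-- The modulus of continuity `ω_m(δ)`. -/
def modulus (ψ : ℝ → ℝ) (𝒢m : Set (Measure ℝ)) (M : ℝ) (fbar : ℝ → ℝ) (δ : ℝ) : ℝ :=
  sSup {d | ∃ G₁ G₂, ModulusFeasible 𝒢m M fbar δ G₁ G₂ ∧ d = linFun ψ G₁ - linFun ψ G₂}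

/-- The modulus problem at `δ` has a solution, i.e. the supremum is attained. -/
def ModulusAttained (ψ : ℝ → ℝ) (𝒢m : Set (Measure ℝ)) (M : ℝ) (fbar : ℝ → ℝ) (δ : ℝ) : Prop :=
  ∃ G₁ G₂, ModulusFeasible 𝒢m M fbar δ G₁ G₂ ∧
    linFun ψ G₁ - linFun ψ G₂ = modulus ψ 𝒢m M fbar δ

/-- The superdifferential at `δ` of a function `w` on `(0, ∞)`. -/
def superdifferential (w : ℝ → ℝ) (δ : ℝ) : Set ℝ :=
  {s | ∀ δ', 0 < δ' → w δ' ≤ w δ + s * (δ' - δ)}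

/-- The worst case squared bias over `𝒢m` of the estimator `Q₀ + m⁻¹ ∑ Q(X_i)` of `L`. -/
def worstSqBias (ψ : ℝ → ℝ) (𝒢m : Set (Measure ℝ)) (Q₀ : ℝ) (Q : ℝ → ℝ) : ℝ≥0∞ :=
  ⨆ H ∈ 𝒢m, ENNReal.ofReal ((Q₀ + (∫ x, Q x ∂(marginal H)) - linFun ψ H) ^ 2)

/-- The worst case bias `B̂`. -/
def worstBias (ψ : ℝ → ℝ) (𝒢m : Set (Measure ℝ)) (Q₀ : ℝ) (Q : ℝ → ℝ) : ℝ≥0∞ :=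
  worstSqBias ψ 𝒢m Q₀ Q ^ (1 / 2 : ℝ)

/-- The weight functions over which the minimax problem is solved: measurable functions `Q` that
are constant on each of the two tails, with `m⁻¹ ∫ Q² f̄ ≤ Γ` (all integrals being finite). -/
def WeightFeasible (m : ℕ) (𝒢m : Set (Measure ℝ)) (M : ℝ) (fbar : ℝ → ℝ) (Γ : ℝ)
    (Q : ℝ → ℝ) : Prop :=
  Measurable Q ∧
    (∃ q, ∀ x ≤ -M, Q x = q) ∧ (∃ q, ∀ x ≥ M, Q x = q) ∧
    (∀ H ∈ 𝒢m, Integrable Q (marginal H)) ∧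
    Integrable (fun x => Q x ^ 2 * fbar x) ∧
    (1 / (m : ℝ)) * ∫ x, Q x ^ 2 * fbar x ≤ Γ

/-- `(Q₀, Q)` minimizes the worst case squared bias over `𝒢m` under the variance constraint. -/
def IsMinimax (m : ℕ) (ψ : ℝ → ℝ) (𝒢m : Set (Measure ℝ)) (M : ℝ) (fbar : ℝ → ℝ) (Γ : ℝ)
    (Q₀ : ℝ) (Q : ℝ → ℝ) : Prop :=
  WeightFeasible m 𝒢m M fbar Γ Q ∧
    ∀ (Q₀' : ℝ) (Q' : ℝ → ℝ), WeightFeasible m 𝒢m M fbar Γ Q' →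
      worstSqBias ψ 𝒢m Q₀ Q ≤ worstSqBias ψ 𝒢m Q₀' Q'

/-- The estimator `L̂ = Q₀ + m⁻¹ ∑_{i ≤ m} Q(x_i)`. -/
def estimator (m : ℕ) (Q₀ : ℝ) (Q : ℝ → ℝ) (x : Fin m → ℝ) : ℝ :=
  Q₀ + (1 / (m : ℝ)) * ∑ i, Q (x i)

/-- The estimated variance `V̂` of `L̂`. -/
def sampleVariance (m : ℕ) (Q : ℝ → ℝ) (x : Fin m → ℝ) : ℝ :=
  (1 / ((m : ℝ) * ((m : ℝ) - 1))) * ((∑ i, Q (x i) ^ 2) - (∑ i, Q (x i)) ^ 2 / (m : ℝ))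

/-- `t̂_α(B, V) = inf {t : P(|b + V^{1/2} Z| > t) < α for all |b| ≤ B}` with `Z ∼ N(0, 1)`;
it takes values in `[0, ∞]`, so that it is infinite when `B` is. -/
def criticalValue (α : ℝ) (B : ℝ≥0∞) (V : ℝ) : ℝ≥0∞ :=
  sInf {t | ∀ b : ℝ, ENNReal.ofReal |b| ≤ B →
    gaussianReal 0 1 {z | t < ENNReal.ofReal |b + √V * z|} < ENNReal.ofReal α}

/-- The interval `L̂ ± t`. -/
def interval (center : ℝ) (t : ℝ≥0∞) : Set ℝ := {y | ENNReal.ofReal |center - y| ≤ t}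

/-- The bias-aware interval `L̂ ± t̂_α(B̂, V̂)` computed from the weights `Q₀, Q` and the second
fold `x`. -/
def biasAwareInterval (α : ℝ) (m : ℕ) (ψ : ℝ → ℝ) (𝒢m : Set (Measure ℝ)) (Q₀ : ℝ) (Q : ℝ → ℝ)
    (x : Fin m → ℝ) : Set ℝ :=
  interval (estimator m Q₀ Q x)
    (criticalValue α (worstBias ψ 𝒢m Q₀ Q) (sampleVariance m Q x))

/-- The first `m` members of a random sequence. -/
def firstObs {Ω : Type*} (X : ℕ → Ω → ℝ) (m : ℕ) (ω : Ω) : Fin m → ℝ := fun i => X i ω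

/-- `P(E m) → 1`, written as `P(E m ᶜ) → 0` so that it has the intended meaning also when the
measurability of `E m` is not known. -/
def TendstoProbOne {Ω : Type*} [MeasurableSpace Ω] (P : Measure Ω) (E : ℕ → Set Ω) : Prop :=
  Tendsto (fun m => P (E m)ᶜ) atTop (𝓝 0)

end

end BiasAware

/-! Conditionally on the first fold, `L̂` is a constant plus an average of i.i.d. terms `Q(X_i)`,
and its bias at `G` is at most `B̂` as soon as `G` lies in the localized class. Coverage thus
follows from asymptotic normality of the studentized average. This needs `Q` to be bounded by a
small multiple of `√m` times its standard deviation, uniformly over good first folds.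

That bound comes from the form of the minimax weights. Collapsing the tails to points and weighting
by the pilot density turns the modulus problem into one about a convex set of pairs `(v, ℓ)` in `L²
× ℝ`: maximize `ℓ` subject to `‖v‖ ≤ δ`. Let `(v₀, ω(δ))` be a solution and `s` a supergradient of
`ω` at `δ`. First-order optimality (`sub_inner_le_of_attained`) shows that the weights `(s/δ) v₀`
reach worst-case bias `(ω(δ) - sδ)/2`. Cauchy–Schwarz, tested on the two distributions behind `v₀`,
shows that no feasible weights do better, and its equality case forces every minimizer to be `(s/δ)
v₀` almost everywhere (`RegularClass.minimax_of_attained`).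

Any two localized densities are within `2c` of each other and the pilot is comparable to `f_G`, so
`|Q|` is of order at most `s c/δ`. If `s > 0` then `‖v₀‖ = δ`, and the variance of `Q` under `f_G`
is at least `s²/2` (`weights_bounds`). The squared ratio of bound to standard deviation is of order
`c²/δ²`, negligible against `m` by assumption. If `s = 0` then `Q = 0` almost everywhere and the
interval almost surely covers.

The probabilistic half is `exists_measure_quantileMiss_le`: the miss probability is at most `α + ε`,
with thresholds that depend only on the law, `α` and `ε`. Missing the target makes the survival
function of `|b + √V̂ Z|`, evaluated at the realized error, smaller than `α`; for an exactly normal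
error this has probability at most `α`. The Gaussian density is bounded, so the approximations cost
the same for every bias `b`. Fubini then integrates over the first fold. -/

namespace BiasAware

/-! ### Central limit theorem for bounded triangular arrays, with uniformity over the summands -/

section CentralLimit

variable {E : Type*} [MeasurableSpace E]

lemma norm_pow_sub_pow_le_mul {a b : ℂ} (ha : ‖a‖ ≤ 1) (hb : ‖b‖ ≤ 1) (n : ℕ) :
    ‖a ^ n - b ^ n‖ ≤ n * ‖a - b‖ := by
  induction n with
  | zero => simp
  | succ n ih =>
    have h : a ^ (n + 1) - b ^ (n + 1) = a ^ n * (a - b) + (a ^ n - b ^ n) * b := by ring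
    rw [h]
    refine (norm_add_le _ _).trans ?_
    rw [norm_mul, norm_mul, norm_pow]
    have h1 : ‖a‖ ^ n * ‖a - b‖ ≤ 1 * ‖a - b‖ := by
      gcongr; exact pow_le_one₀ (norm_nonneg _) ha
    have h2 : ‖a ^ n - b ^ n‖ * ‖b‖ ≤ (n * ‖a - b‖) * 1 := by gcongr
    push_cast
    linarith

lemma norm_exp_mul_I_sub_le {u : ℝ} (hu : |u| ≤ 1) :
    ‖Complex.exp (u * Complex.I) - (1 + u * Complex.I - (u : ℂ) ^ 2 / 2)‖ ≤ |u| ^ 3 := by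
  have hn : ‖(u : ℂ) * Complex.I‖ = |u| := by simp
  have h := Complex.exp_bound (x := u * Complex.I) (by rw [hn]; exact hu) (n := 3) (by norm_num)
  rw [hn] at h
  have hs : ∑ m ∈ Finset.range 3, ((u : ℂ) * Complex.I) ^ m / (m.factorial : ℂ)
      = 1 + u * Complex.I - (u : ℂ) ^ 2 / 2 := by
    simp [Finset.sum_range_succ, mul_pow, Nat.factorial]
    ring
  rw [hs] at h
  refine h.trans ?_
  have : (0 : ℝ) ≤ |u| ^ 3 := by positivity
  norm_num [Nat.factorial]
  linarith

/-- Second-order Taylor expansion under the integral. The condition `|t| K ≤ 1` keeps the argument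
in the range of the expansion, and the cubic remainder is integrable with a small constant because
`|Y|³ ≤ K Y²`. -/
lemma norm_charFun_map_sub_le (μ : Measure E) [IsProbabilityMeasure μ] {Y : E → ℝ}
    (hY : Measurable Y) (h0 : ∫ x, Y x ∂μ = 0) (h1 : ∫ x, Y x ^ 2 ∂μ = 1) {K t : ℝ}
    (hK : ∀ᵐ x ∂μ, |Y x| ≤ K) (ht : |t| * K ≤ 1) :
    ‖charFun (μ.map Y) t - (1 - (t : ℂ) ^ 2 / 2)‖ ≤ |t| ^ 3 * K := by
  have hYi : Integrable Y μ := Integrable.of_bound hY.aestronglyMeasurable K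
    (by simpa using hK)
  have hY2 : Integrable (fun x => Y x ^ 2) μ := by
    refine Integrable.of_bound (hY.pow_const 2).aestronglyMeasurable (K ^ 2) ?_
    filter_upwards [hK] with x hx
    rw [Real.norm_eq_abs, abs_pow]
    exact pow_le_pow_left₀ (abs_nonneg _) hx 2
  rw [charFun_apply_real, integral_map hY.aemeasurable (by fun_prop)]
  have hexp : Integrable (fun x => Complex.exp (t * Y x * Complex.I)) μ := by
    refine Integrable.of_bound (by fun_prop) 1 (ae_of_all _ fun x => ?_)
    rw [← Complex.ofReal_mul, Complex.norm_exp_ofReal_mul_I]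
  have hA : Integrable (fun x => ((t * Y x : ℝ) : ℂ) * Complex.I) μ :=
    ((hYi.const_mul t).ofReal).mul_const _
  have hB : Integrable (fun x => ((t * Y x : ℝ) : ℂ) ^ 2 / 2) μ := by
    have : Integrable (fun x => (((t ^ 2 * Y x ^ 2 : ℝ) : ℂ)) / 2) μ :=
      ((hY2.const_mul (t ^ 2)).ofReal).div_const _
    refine this.congr (ae_of_all _ fun x => ?_)
    push_cast; ring
  have hC : Integrable (fun x => 1 + ((t * Y x : ℝ) : ℂ) * Complex.I) μ :=
    (integrable_const _).add hA
  have hD : Integrable (fun x => 1 + ((t * Y x : ℝ) : ℂ) * Complex.I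
      - ((t * Y x : ℝ) : ℂ) ^ 2 / 2) μ := hC.sub hB
  have hpoly : (1 - (t : ℂ) ^ 2 / 2)
      = ∫ x, (1 + ((t * Y x : ℝ) : ℂ) * Complex.I - ((t * Y x : ℝ) : ℂ) ^ 2 / 2) ∂μ := by
    rw [integral_sub hC hB, integral_add (integrable_const _) hA,
      integral_mul_const, integral_complex_ofReal, integral_const_mul, h0]
    have : ∫ x, ((t * Y x : ℝ) : ℂ) ^ 2 / 2 ∂μ = (t : ℂ) ^ 2 / 2 := by
      rw [integral_div]
      have : ∫ x, ((t * Y x : ℝ) : ℂ) ^ 2 ∂μ = ((∫ x, t ^ 2 * Y x ^ 2 ∂μ : ℝ) : ℂ) := by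
        rw [← integral_complex_ofReal]
        congr 1; ext x; push_cast; ring
      rw [this, integral_const_mul, h1]; push_cast; ring
    rw [this]; simp
  rw [hpoly, ← integral_sub hexp hD]
  refine (norm_integral_le_integral_norm _).trans ?_
  have hb : ∀ᵐ x ∂μ, ‖Complex.exp (t * Y x * Complex.I)
      - (1 + ((t * Y x : ℝ) : ℂ) * Complex.I - ((t * Y x : ℝ) : ℂ) ^ 2 / 2)‖
      ≤ |t| ^ 3 * K * Y x ^ 2 := by
    filter_upwards [hK] with x hx
    have hu : |t * Y x| ≤ 1 := by
      rw [abs_mul]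
      exact (mul_le_mul_of_nonneg_left hx (abs_nonneg _)).trans ht
    have := norm_exp_mul_I_sub_le hu
    push_cast at this ⊢
    refine this.trans ?_
    rw [abs_mul, mul_pow, mul_assoc]
    gcongr
    rw [← sq_abs (Y x)]
    have : |Y x| ^ 3 = |Y x| * |Y x| ^ 2 := by ring
    rw [this]
    gcongr
  refine (integral_mono_ae (hexp.sub hD).norm
    (hY2.const_mul _) hb).trans ?_
  rw [integral_const_mul, h1, mul_one]

lemma norm_cexp_neg_sq_sub_le {t : ℝ} (ht : |t| ≤ 1) :
    ‖Complex.exp (-(t : ℂ) ^ 2 / 2) - (1 - (t : ℂ) ^ 2 / 2)‖ ≤ t ^ 4 := by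
  have hn : ‖-(t : ℂ) ^ 2 / 2‖ = t ^ 2 / 2 := by simp
  have ht2 : t ^ 2 ≤ 1 := by rw [← sq_abs]; exact pow_le_one₀ (abs_nonneg _) ht
  have h := Complex.norm_exp_sub_one_sub_id_le (x := -(t : ℂ) ^ 2 / 2)
    (by rw [hn]; linarith)
  rw [hn] at h
  have e : Complex.exp (-(t : ℂ) ^ 2 / 2) - (1 - (t : ℂ) ^ 2 / 2)
    = Complex.exp (-(t : ℂ) ^ 2 / 2) - 1 - -(t : ℂ) ^ 2 / 2 := by ring
  rw [e]
  refine h.trans ?_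
  nlinarith [sq_nonneg (t ^ 2)]

/-- The law of the normalized sum of `m` independent copies of `Y`. -/
noncomputable def sumLaw (μ : Measure E) (Y : E → ℝ) (m : ℕ) : Measure ℝ :=
  (Measure.pi fun _ : Fin m => μ).map fun x => (√(m : ℝ))⁻¹ * ∑ i, Y (x i)

lemma measurable_normalizedSum {Y : E → ℝ} (hY : Measurable Y) (m : ℕ) :
    Measurable fun x : Fin m → E => (√(m : ℝ))⁻¹ * ∑ i, Y (x i) := by
  fun_prop

lemma isProbabilityMeasure_sumLaw (μ : Measure E) [IsProbabilityMeasure μ] {Y : E → ℝ}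
    (hY : Measurable Y) (m : ℕ) : IsProbabilityMeasure (sumLaw μ Y m) :=
  Measure.isProbabilityMeasure_map (measurable_normalizedSum hY m).aemeasurable

lemma charFun_sumLaw (μ : Measure E) [IsProbabilityMeasure μ] {Y : E → ℝ}
    (hY : Measurable Y) (m : ℕ) (t : ℝ) :
    charFun (sumLaw μ Y m) t = charFun (μ.map Y) ((√(m : ℝ))⁻¹ * t) ^ m := by
  unfold sumLaw
  have hmeas : ∀ i : Fin m, AEMeasurable (fun x : Fin m → E => Y (x i))
      (Measure.pi fun _ : Fin m => μ) :=
    fun i => (hY.comp (measurable_pi_apply i)).aemeasurable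
  rw [charFun_map_mul_comp (Finset.aemeasurable_fun_sum _ fun i _ => hmeas i),
    iIndepFun.charFun_map_fun_sum_eq_prod hmeas
      (iIndepFun_pi (X := fun _ => Y) fun _ => hY.aemeasurable)]
  have : ∀ i : Fin m, (Measure.pi fun _ : Fin m => μ).map (fun x => Y (x i)) = μ.map Y := by
    intro i
    have h := (measurePreserving_eval (fun _ : Fin m => μ) i)
    rw [← Function.comp_def Y (fun x : Fin m → E => x i),
      ← Measure.map_map hY (measurable_pi_apply i)]
    exact congrArg (Measure.map Y) h.map_eq
  simp [this]

/-- Both characteristic functions are `m`-th powers of numbers in the unit disc, so their distance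
is at most `m` times the distance of the bases at `t/√m`. Each base is close to `1 - t²/(2m)`. -/
lemma norm_charFun_sumLaw_sub_le (μ : Measure E) [IsProbabilityMeasure μ] {Y : E → ℝ}
    (hY : Measurable Y) (h0 : ∫ x, Y x ∂μ = 0) (h1 : ∫ x, Y x ^ 2 ∂μ = 1) {K t : ℝ} {m : ℕ}
    (hm : 0 < m) (hK : ∀ᵐ x ∂μ, |Y x| ≤ K) (ht : |t| / √(m : ℝ) ≤ 1) (htK : |t| * (K / √(m : ℝ)) ≤ 1) :
    ‖charFun (sumLaw μ Y m) t - charFun (gaussianReal 0 1) t‖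
      ≤ |t| ^ 3 * (K / √(m : ℝ)) + t ^ 4 / m := by
  have : IsProbabilityMeasure (μ.map Y) := Measure.isProbabilityMeasure_map hY.aemeasurable
  have hm' : (0 : ℝ) < m := by exact_mod_cast hm
  have hs : 0 < √(m : ℝ) := Real.sqrt_pos.2 hm'
  have hss : √(m : ℝ) ^ 2 = m := Real.sq_sqrt hm'.le
  set s := (√(m : ℝ))⁻¹ * t with hsdef
  have hsabs : |s| = |t| / √(m : ℝ) := by
    rw [hsdef, abs_mul, abs_of_pos (inv_pos.2 hs)]; field_simp
  have hms : (m : ℝ) * s ^ 2 = t ^ 2 := by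
    rw [hsdef, mul_pow, inv_pow, hss]; field_simp
  have hg : charFun (gaussianReal 0 1) t = Complex.exp (-(s : ℂ) ^ 2 / 2) ^ m := by
    rw [charFun_gaussianReal, ← Complex.exp_nat_mul]
    congr 1
    have : ((m : ℂ)) * (s : ℂ) ^ 2 = (t : ℂ) ^ 2 := by exact_mod_cast hms
    push_cast
    linear_combination (1 / 2 : ℂ) * this
  rw [charFun_sumLaw μ hY, hg]
  have hnexp : ‖Complex.exp (-(s : ℂ) ^ 2 / 2)‖ ≤ 1 := by
    rw [Complex.norm_exp]
    have : (-(s : ℂ) ^ 2 / 2).re = -s ^ 2 / 2 := by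
      rw [← Complex.ofReal_pow, ← Complex.ofReal_neg]
      have : ((2 : ℂ)) = ((2 : ℝ) : ℂ) := by norm_num
      rw [this, ← Complex.ofReal_div, Complex.ofReal_re]
    rw [this]
    exact Real.exp_le_one_iff.2 (by nlinarith [sq_nonneg s])
  refine (norm_pow_sub_pow_le_mul (norm_charFun_le_one _) hnexp m).trans ?_
  have hA := norm_charFun_map_sub_le μ hY h0 h1 hK (t := s) (by rw [hsabs]; calc
    |t| / √(m : ℝ) * K = |t| * (K / √(m : ℝ)) := by ring
    _ ≤ 1 := htK)
  have hB := norm_cexp_neg_sq_sub_le (t := s) (by rw [hsabs]; exact ht)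
  have htri : ‖charFun (μ.map Y) s - Complex.exp (-(s : ℂ) ^ 2 / 2)‖ ≤ |s| ^ 3 * K + s ^ 4 := by
    rw [← sub_sub_sub_cancel_right _ _ (1 - (s : ℂ) ^ 2 / 2)]
    exact (norm_sub_le _ _).trans (add_le_add hA hB)
  refine (mul_le_mul_of_nonneg_left htri hm'.le).trans (le_of_eq ?_)
  have e1 : (m : ℝ) * |s| ^ 3 = |t| ^ 3 / √(m : ℝ) := by
    rw [hsabs, div_pow]
    have : √(m : ℝ) ^ 3 = m * √(m : ℝ) := by rw [pow_succ, hss]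
    rw [this]; field_simp
  have e2 : (m : ℝ) * s ^ 4 = t ^ 4 / m := by
    have : (m : ℝ) * s ^ 4 = (m * s ^ 2) ^ 2 / m := by field_simp
    rw [this, hms]; ring
  rw [mul_add, ← mul_assoc, e1, e2]; ring

/-- The central limit theorem for row-wise i.i.d. bounded triangular arrays. -/
lemma tendsto_charFun_sumLaw (μ : Measure E) [IsProbabilityMeasure μ] {Y : ℕ → E → ℝ}
    (hY : ∀ n, Measurable (Y n)) (h0 : ∀ n, ∫ x, Y n x ∂μ = 0)
    (h1 : ∀ n, ∫ x, Y n x ^ 2 ∂μ = 1) {K : ℕ → ℝ} {m : ℕ → ℕ}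
    (hK : ∀ n, ∀ᵐ x ∂μ, |Y n x| ≤ K n) (hm : Tendsto m atTop atTop)
    (hKm : Tendsto (fun n => K n / √(m n : ℝ)) atTop (𝓝 0)) (t : ℝ) :
    Tendsto (fun n => charFun (sumLaw μ (Y n) (m n)) t) atTop
      (𝓝 (charFun (gaussianReal 0 1) t)) := by
  rw [tendsto_iff_norm_sub_tendsto_zero]
  have hmr : Tendsto (fun n => (m n : ℝ)) atTop atTop := tendsto_natCast_atTop_atTop.comp hm
  have hms : Tendsto (fun n => √(m n : ℝ)) atTop atTop := Real.tendsto_sqrt_atTop.comp hmr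
  have l1 : Tendsto (fun n => |t| / √(m n : ℝ)) atTop (𝓝 0) := hms.const_div_atTop _
  have l2 : Tendsto (fun n => |t| * (K n / √(m n : ℝ))) atTop (𝓝 0) := by
    simpa using hKm.const_mul |t|
  have l3 : Tendsto (fun n => |t| ^ 3 * (K n / √(m n : ℝ)) + t ^ 4 / (m n : ℝ)) atTop (𝓝 0) := by
    simpa using (hKm.const_mul (|t| ^ 3)).add (hmr.const_div_atTop (t ^ 4))
  refine squeeze_zero' (Eventually.of_forall fun n => norm_nonneg _) ?_ l3
  filter_upwards [l1.eventually (eventually_le_nhds zero_lt_one),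
    l2.eventually (eventually_le_nhds zero_lt_one), hm.eventually_gt_atTop 0] with n a b c
  exact norm_charFun_sumLaw_sub_le μ (hY n) (h0 n) (h1 n) c (hK n) a b

/-- A uniform version of the central limit theorem in the Lévy–Prokhorov distance. -/
lemma exists_levyProkhorovEDist_sumLaw_lt (μ : Measure E) [IsProbabilityMeasure μ] {ε : ℝ≥0∞}
    (hε : 0 < ε) :
    ∃ κ > 0, ∃ m₀ : ℕ, ∀ m ≥ m₀, ∀ (Y : E → ℝ) (K : ℝ), Measurable Y → ∫ x, Y x ∂μ = 0 →
      ∫ x, Y x ^ 2 ∂μ = 1 → (∀ᵐ x ∂μ, |Y x| ≤ K) → K ^ 2 ≤ κ * m →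
      levyProkhorovEDist (sumLaw μ Y m) (gaussianReal 0 1) < ε := by
  -- If no thresholds worked, counterexamples with `κ = 1/(n+1)` and `m ≥ n+1` would form a
  -- triangular array. Its characteristic functions converge to the Gaussian one, hence it converges
  -- weakly and in the Lévy–Prokhorov distance, a contradiction.
  by_contra! hcon
  have hκ : ∀ n : ℕ, (0 : ℝ) < 1 / ((n : ℝ) + 1) := fun n => Nat.one_div_pos_of_nat
  choose m hmge Y K hY h0 h1 hK hKm hge using fun n : ℕ => hcon _ (hκ n) (n + 1)
  have hm : Tendsto m atTop atTop :=
    tendsto_atTop_mono (fun n => (Nat.le_succ n).trans (hmge n)) tendsto_id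
  have hK0 : ∀ n, 0 ≤ K n := by
    intro n
    obtain ⟨x, hx⟩ := (hK n).exists
    exact (abs_nonneg _).trans hx
  have hlim : Tendsto (fun n => K n / √(m n : ℝ)) atTop (𝓝 0) := by
    have hs : Tendsto (fun n : ℕ => √(1 / ((n : ℝ) + 1))) atTop (𝓝 0) := by
      simpa using (tendsto_one_div_add_atTop_nhds_zero_nat (𝕜 := ℝ)).sqrt
    refine squeeze_zero (fun n => div_nonneg (hK0 n) (Real.sqrt_nonneg _)) (fun n => ?_) hs
    have hmpos : (0 : ℝ) < m n := by exact_mod_cast (Nat.succ_pos n).trans_le (hmge n)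
    rw [div_le_iff₀ (Real.sqrt_pos.2 hmpos), ← Real.sqrt_mul (hκ n).le]
    exact Real.le_sqrt_of_sq_le (hKm n)
  have hp : ∀ n, IsProbabilityMeasure (sumLaw μ (Y n) (m n)) :=
    fun n => isProbabilityMeasure_sumLaw μ (hY n) (m n)
  let ν : ℕ → ProbabilityMeasure ℝ := fun n => ⟨sumLaw μ (Y n) (m n), hp n⟩
  let γ : ProbabilityMeasure ℝ := ⟨gaussianReal 0 1, inferInstance⟩
  have hν : Tendsto ν atTop (𝓝 γ) :=
    ProbabilityMeasure.tendsto_of_tendsto_charFun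
      fun t => tendsto_charFun_sumLaw μ hY h0 h1 hK hm hlim t
  have hLP := (LevyProkhorov.continuous_ofMeasure_probabilityMeasure.tendsto γ).comp hν
  rw [EMetric.tendsto_atTop] at hLP
  obtain ⟨N, hN⟩ := hLP ε hε
  have := hN N le_rfl
  rw [Function.comp_apply, LevyProkhorov.edist_probabilityMeasure_def] at this
  exact absurd this (not_lt.2 (hge N))

end CentralLimit

/-! ### Consistency of the sample variance -/

section SampleVariance

variable {E : Type*} [MeasurableSpace E]

lemma measure_pi_abs_sum_sub_ge_le (μ : Measure E) [IsProbabilityMeasure μ] {f : E → ℝ}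
    (hf : MemLp f 2 μ) (m : ℕ) {c : ℝ} (hc : 0 < c) :
    (Measure.pi fun _ : Fin m => μ) {x | c ≤ |∑ i, f (x i) - m * ∫ y, f y ∂μ|}
      ≤ ENNReal.ofReal (m * Var[f; μ] / c ^ 2) := by
  have hmp : ∀ i : Fin m, MeasurePreserving (fun x : Fin m → E => x i)
      (Measure.pi fun _ : Fin m => μ) μ := fun i => measurePreserving_eval (fun _ : Fin m => μ) i
  have hi : ∀ i : Fin m, MemLp (fun x : Fin m → E => f (x i)) 2 (Measure.pi fun _ : Fin m => μ) :=
    fun i => hf.comp_measurePreserving (hmp i)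
  have hS : MemLp (∑ i : Fin m, fun x : Fin m → E => f (x i)) 2
      (Measure.pi fun _ : Fin m => μ) := memLp_finsetSum' _ fun i _ => hi i
  have hint : ∫ x, (∑ i : Fin m, fun x : Fin m → E => f (x i)) x
      ∂(Measure.pi fun _ : Fin m => μ) = m * ∫ y, f y ∂μ := by
    simp only [Finset.sum_apply]
    rw [integral_finsetSum _ fun i _ => (hi i).integrable (by norm_num)]
    have : ∀ i : Fin m, ∫ x, f (x i) ∂(Measure.pi fun _ : Fin m => μ) = ∫ y, f y ∂μ := by
      intro i
      have h := (hmp i).map_eq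
      conv_rhs => rw [← h]
      rw [integral_map (hmp i).measurable.aemeasurable]
      rw [h]; exact hf.aestronglyMeasurable
    simp [this]
  have h := meas_ge_le_variance_div_sq hS hc
  rw [hint, variance_sum_pi (X := fun _ : Fin m => f) (fun _ => hf)] at h
  simpa using h

/-- Chebyshev's inequality for the sums of `Y²` and of `Y`. The bound on `Y` enters through `Var(Y²)
≤ E Y⁴ ≤ K² E Y² = K²`. -/
lemma measure_pi_sampleVariance_far_le (μ : Measure ℝ) [IsProbabilityMeasure μ] {Y : ℝ → ℝ}
    (hY : Measurable Y) (h0 : ∫ x, Y x ∂μ = 0) (h1 : ∫ x, Y x ^ 2 ∂μ = 1) {K η : ℝ} {m : ℕ}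
    (hK : ∀ᵐ x ∂μ, |Y x| ≤ K) (hη : 0 < η) (hη1 : η ≤ 1) (hm : 4 ≤ m * η) :
    (Measure.pi fun _ : Fin m => μ) {x | η < |m * sampleVariance m Y x - 1|}
      ≤ ENNReal.ofReal (16 * K ^ 2 / (m * η ^ 2)) + ENNReal.ofReal (4 / (m * η)) := by
  have hm4 : (4 : ℝ) ≤ m := by nlinarith [(Nat.cast_nonneg m : (0 : ℝ) ≤ m)]
  have hm0 : (0 : ℝ) < m := by linarith
  have hYb : ∀ᵐ x ∂μ, ‖Y x‖ ≤ K := by simpa using hK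
  have hYm : MemLp Y 2 μ := MemLp.of_bound hY.aestronglyMeasurable K hYb
  have hY2m : MemLp (fun x => Y x ^ 2) 2 μ := by
    refine MemLp.of_bound (hY.pow_const 2).aestronglyMeasurable (K ^ 2) ?_
    filter_upwards [hK] with x hx
    rw [Real.norm_eq_abs, abs_pow]
    exact pow_le_pow_left₀ (abs_nonneg _) hx 2
  have hv1 : Var[Y; μ] = 1 := by
    rw [variance_eq_sub hYm]
    simp [h0, h1]
  have hv2 : Var[fun x => Y x ^ 2; μ] ≤ K ^ 2 := by
    refine (variance_le_expectation_sq (hY.pow_const 2).aestronglyMeasurable).trans ?_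
    have hb : ∀ᵐ x ∂μ, ((fun x => Y x ^ 2) ^ 2) x ≤ K ^ 2 * Y x ^ 2 := by
      filter_upwards [hK] with x hx
      have : Y x ^ 2 ≤ K ^ 2 := by
        rw [← sq_abs]; exact pow_le_pow_left₀ (abs_nonneg _) hx 2
      simp only [Pi.pow_apply]
      nlinarith [sq_nonneg (Y x)]
    refine (integral_mono_ae hY2m.integrable_sq ((hYm.integrable_sq).const_mul _) hb).trans ?_
    rw [integral_const_mul, h1, mul_one]
  have hA := measure_pi_abs_sum_sub_ge_le μ hY2m m (c := m * η / 4) (by positivity)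
  have hB := measure_pi_abs_sum_sub_ge_le μ hYm m (c := m * √η / 2) (by positivity)
  rw [h1, mul_one] at hA
  rw [h0, mul_zero, hv1] at hB
  simp only [sub_zero] at hB
  -- With `S₁`, `S₂` the sums of `Y` and `Y²`, the deviation equals `(S₂ - m - S₁²/m + 1)/(m - 1)`.
  -- Off the right-hand side, `|S₂ - m|` and `S₁²/m` are at most `mη/4`, and `4 ≤ mη` absorbs the
  -- summand `1`.
  have hsub : {x : Fin m → ℝ | η < |m * sampleVariance m Y x - 1|}
      ⊆ {x | m * η / 4 ≤ |∑ i, Y (x i) ^ 2 - m|} ∪ {x | m * √η / 2 ≤ |∑ i, Y (x i)|} := by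
    intro x hx
    by_contra hn
    simp only [Set.mem_union, Set.mem_ofPred_eq, not_or, not_le] at hn
    obtain ⟨ha, hb⟩ := hn
    suffices hle : |m * sampleVariance m Y x - 1| ≤ η from absurd hx (not_lt.2 hle)
    set S2 := ∑ i, Y (x i) ^ 2
    set S1 := ∑ i, Y (x i)
    have hS1 : S1 ^ 2 / m ≤ m * η / 4 := by
      rw [div_le_iff₀ hm0, ← sq_abs]
      have := pow_le_pow_left₀ (abs_nonneg _) hb.le 2
      have e : (m * √η / 2) ^ 2 = m * η / 4 * m := by
        rw [div_pow, mul_pow, Real.sq_sqrt hη.le]; ring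
      linarith
    have hS1' : 0 ≤ S1 ^ 2 / m := by positivity
    have hsv : m * sampleVariance m Y x - 1 = (S2 - m - S1 ^ 2 / m + 1) / (m - 1) := by
      unfold sampleVariance
      have : (m : ℝ) - 1 ≠ 0 := by linarith
      field_simp
      ring
    rw [hsv, abs_div, abs_of_pos (show (0 : ℝ) < m - 1 by linarith),
      div_le_iff₀ (by linarith)]
    rw [abs_lt] at ha
    rw [abs_le]
    constructor <;> nlinarith
  refine (measure_mono hsub).trans ((measure_union_le _ _).trans (add_le_add ?_ ?_))
  · refine hA.trans (ENNReal.ofReal_le_ofReal ?_)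
    rw [div_le_div_iff₀ (by positivity) (by positivity)]
    have : m * Var[fun x => Y x ^ 2; μ] ≤ m * K ^ 2 := by gcongr
    have h2 : 0 ≤ m * η ^ 2 := by positivity
    have := mul_le_mul_of_nonneg_right this h2
    nlinarith
  · refine hB.trans (ENNReal.ofReal_le_ofReal (le_of_eq ?_))
    rw [div_pow, mul_pow, Real.sq_sqrt hη.le]
    field_simp
    norm_num

end SampleVariance

/-! ### Survival functions of folded normal variables -/

section Survival

/-- A random variable falls into an upper set with probability at most the supremum of its
survival function over this set. -/
lemma measure_preimage_le_of_isUpperSet {E : Type*} [MeasurableSpace E] (μ : Measure E)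
    {U : Set ℝ} (hU : IsUpperSet U) (g : E → ℝ) {c : ℝ≥0∞}
    (h : ∀ y ∈ U, μ {x | y ≤ g x} ≤ c) : μ (g ⁻¹' U) ≤ c := by
  by_cases hmin : ∃ y ∈ U, ∀ z ∈ U, y ≤ z
  · obtain ⟨y, hy, hyz⟩ := hmin
    have hsub : g ⁻¹' U ⊆ {x | y ≤ g x} := fun x hx => hyz _ hx
    exact (measure_mono hsub).trans (h y hy)
  -- Without a least element, the preimage is covered by a directed countable union over rational
  -- points of `U`. Continuity from below along it does not need `g` to be measurable.
  · push Not at hmin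
    have hcov : g ⁻¹' U ⊆ ⋃ q : {q : ℚ // (q : ℝ) ∈ U}, {x | ((q : ℚ) : ℝ) ≤ g x} := by
      intro x hx
      obtain ⟨z, hz, hzx⟩ := hmin (g x) hx
      obtain ⟨q, hq1, hq2⟩ := exists_rat_btwn hzx
      exact Set.mem_iUnion.2 ⟨⟨q, hU hq1.le hz⟩, hq2.le⟩
    refine (measure_mono hcov).trans ?_
    rw [Directed.measure_iUnion]
    · exact iSup_le fun q => h _ q.2
    · intro p q
      rcases le_total ((p : ℚ) : ℝ) ((q : ℚ) : ℝ) with hpq | hpq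
      · exact ⟨p, subset_rfl, fun x hx => hpq.trans hx⟩
      · exact ⟨q, fun x hx => hpq.trans hx, subset_rfl⟩

lemma gaussianPDFReal_std_le_one (x : ℝ) : gaussianPDFReal 0 1 x ≤ 1 := by
  rw [gaussianPDFReal]
  have h1 : (√(2 * Real.pi * ((1 : ℝ≥0) : ℝ)))⁻¹ ≤ 1 := by
    refine inv_le_one_of_one_le₀ (Real.one_le_sqrt.2 ?_)
    push_cast
    nlinarith [Real.pi_gt_three]
  have h2 : Real.exp (-(x - 0) ^ 2 / (2 * ((1 : ℝ≥0) : ℝ))) ≤ 1 := by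
    rw [Real.exp_le_one_iff]
    push_cast
    nlinarith [sq_nonneg x]
  calc _ ≤ (1 : ℝ) * 1 := by gcongr
    _ = 1 := by ring

lemma gaussianReal_le_volume (s : Set ℝ) : gaussianReal 0 1 s ≤ volume s := by
  rw [gaussianReal_apply 0 one_ne_zero, ← setLIntegral_one]
  refine lintegral_mono fun x => ?_
  rw [gaussianPDF, ← ENNReal.ofReal_one]
  exact ENNReal.ofReal_le_ofReal (gaussianPDFReal_std_le_one x)

/-- The survival function `y ↦ P(|β + Z| ≥ y)` of a folded normal variable. -/
noncomputable def foldedSurvival (β y : ℝ) : ℝ≥0∞ := gaussianReal 0 1 {z | y ≤ |β + z|}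

lemma foldedSurvival_anti (β : ℝ) {y y' : ℝ} (h : y ≤ y') :
    foldedSurvival β y' ≤ foldedSurvival β y :=
  measure_mono fun _ hz => h.trans hz

/-- The additional event confines `z` to two intervals of length `s`, and the normal density is at
most `1`. The bound does not depend on `β`. -/
lemma foldedSurvival_sub_le (β y : ℝ) {s : ℝ} (hs : 0 ≤ s) :
    foldedSurvival β (y - s) ≤ foldedSurvival β y + ENNReal.ofReal (2 * s) := by
  have hsub : {z : ℝ | y - s ≤ |β + z|} ⊆ {z | y ≤ |β + z|} ∪
      (Set.Icc (y - s - β) (y - β) ∪ Set.Icc (-y - β) (-y + s - β)) := by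
    intro z hz
    by_cases h : y ≤ |β + z|
    · exact Or.inl h
    · right
      simp only [Set.mem_ofPred_eq, not_le] at hz h
      rcases le_total 0 (β + z) with h0 | h0
      · left; rw [abs_of_nonneg h0] at hz h; constructor <;> linarith
      · right; rw [abs_of_nonpos h0] at hz h; constructor <;> linarith
  refine (measure_mono hsub).trans ((measure_union_le _ _).trans ?_)
  refine add_le_add le_rfl ((measure_union_le _ _).trans ?_)
  refine (add_le_add (gaussianReal_le_volume _) (gaussianReal_le_volume _)).trans (le_of_eq ?_)
  rw [Real.volume_Icc, Real.volume_Icc, ← ENNReal.ofReal_add (by linarith) (by linarith)]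
  congr 1; ring

/-- A variable inserted into its own survival function is stochastically at least uniform; the shift
by `s` costs the increment `2s`. -/
lemma gaussianReal_foldedSurvival_lt_le (β : ℝ) {s : ℝ} (hs : 0 ≤ s) (a : ℝ≥0∞) :
    gaussianReal 0 1 {t | foldedSurvival β (|β + t| + s) < a} ≤ a + ENNReal.ofReal (2 * s) := by
  have hU : IsUpperSet {y : ℝ | foldedSurvival β (y + s) < a} := fun y y' h hy =>
    (foldedSurvival_anti β (by linarith)).trans_lt hy
  refine measure_preimage_le_of_isUpperSet (gaussianReal 0 1) hU (fun t => |β + t|) fun y hy => ?_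
  have := foldedSurvival_sub_le β (y + s) hs
  rw [add_sub_cancel_right] at this
  exact this.trans (add_le_add (le_of_lt hy) le_rfl)

lemma gaussianReal_abs_gt_le {R : ℝ} (hR : 0 < R) :
    gaussianReal 0 1 {z | R < |z|} ≤ ENNReal.ofReal (1 / R ^ 2) := by
  have h := meas_ge_le_variance_div_sq (memLp_id_gaussianReal (μ := 0) (v := 1) 2) hR
  rw [variance_id_gaussianReal] at h
  simp only [id, integral_id_gaussianReal, sub_zero, NNReal.coe_one] at h
  have hsub : {z : ℝ | R < |z|} ⊆ {z | R ≤ |z|} := fun z hz =>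
    le_of_lt (show R < |z| from hz)
  exact (measure_mono hsub).trans h

/-- Unless `|z| > R`, replacing the scale `1` by `v` moves `β + z` by at most `ηR`. -/
lemma foldedSurvival_le_of_scale (β y : ℝ) {v η R : ℝ} (hv : |v - 1| ≤ η) (hR : 0 < R) :
    foldedSurvival β (y + η * R)
      ≤ gaussianReal 0 1 {z | y ≤ |β + v * z|} + ENNReal.ofReal (1 / R ^ 2) := by
  have hsub : {z : ℝ | y + η * R ≤ |β + z|} ⊆ {z | y ≤ |β + v * z|} ∪ {z | R < |z|} := by
    intro z hz
    by_cases h : R < |z|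
    · exact Or.inr h
    · left
      simp only [Set.mem_ofPred_eq, not_lt] at h hz ⊢
      have h1 : |β + z| ≤ |β + v * z| + |(v - 1) * z| := by
        have : β + z = (β + v * z) - (v - 1) * z := by ring
        rw [this]; exact abs_sub _ _
      have h2 : |(v - 1) * z| ≤ η * R := by
        rw [abs_mul]; exact mul_le_mul hv h (abs_nonneg _) ((abs_nonneg _).trans hv)
      linarith
  exact (measure_mono hsub).trans ((measure_union_le _ _).trans
    (add_le_add le_rfl (gaussianReal_abs_gt_le hR)))

lemma measurable_foldedSurvival (β : ℝ) : Measurable (foldedSurvival β) :=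
  (show Antitone (foldedSurvival β) from fun _ _ h => foldedSurvival_anti β h).measurable

end Survival

/-! ### Miss probability for an arbitrary bias -/

section Coverage

/-- When the sample variance is close to one, a miss places the normalized sum in a fixed set `B`.
The Lévy–Prokhorov bound passes to the Gaussian measure of a thickening of `B`. The scale error and
the thickening each shift the survival function by `ε`, and the total shift `2ε` costs `4ε`. -/
lemma measure_pi_standardized_noncoverage_le (μ : Measure ℝ) [IsProbabilityMeasure μ] (α : ℝ≥0∞)
    {Y : ℝ → ℝ} (hY : Measurable Y) {m : ℕ} {η R ε : ℝ} (hη1 : η ≤ 1)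
    (hR : 0 < R) (hε : 0 < ε) (hηR : η * R ≤ ε)
    (hLP : levyProkhorovEDist (sumLaw μ Y m) (gaussianReal 0 1) < ENNReal.ofReal ε) (β : ℝ) :
    (Measure.pi fun _ : Fin m => μ) {x | gaussianReal 0 1
        {z | |β + (√(m : ℝ))⁻¹ * ∑ i, Y (x i)| ≤ |β + √(m * sampleVariance m Y x) * z|} < α}
      ≤ (Measure.pi fun _ : Fin m => μ) {x | η < |m * sampleVariance m Y x - 1|}
        + (α + ENNReal.ofReal (1 / R ^ 2) + ENNReal.ofReal (4 * ε) + ENNReal.ofReal ε) := by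
  set a := α + ENNReal.ofReal (1 / R ^ 2)
  set B : Set ℝ := {t | foldedSurvival β (|β + t| + ε) < a} with hB
  have hBm : MeasurableSet B :=
    measurableSet_lt ((measurable_foldedSurvival β).comp (by fun_prop)) measurable_const
  have hsub : {x : Fin m → ℝ | gaussianReal 0 1
      {z | |β + (√(m : ℝ))⁻¹ * ∑ i, Y (x i)| ≤ |β + √(m * sampleVariance m Y x) * z|} < α}
      ⊆ {x | η < |m * sampleVariance m Y x - 1|}
        ∪ (fun x => (√(m : ℝ))⁻¹ * ∑ i, Y (x i)) ⁻¹' B := by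
    intro x hx
    by_cases hfar : η < |m * sampleVariance m Y x - 1|
    · exact Or.inl hfar
    right
    rw [not_lt] at hfar
    set W := m * sampleVariance m Y x
    have hW : 0 ≤ W := by linarith [(abs_le.1 hfar).1]
    have hs : |√W - 1| ≤ η := by
      refine le_trans ?_ hfar
      have : W - 1 = (√W - 1) * (√W + 1) := by nlinarith [Real.sq_sqrt hW]
      rw [this, abs_mul]
      refine le_mul_of_one_le_right (abs_nonneg _) ?_
      rw [abs_of_nonneg (by positivity)]
      linarith [Real.sqrt_nonneg W]
    have h := foldedSurvival_le_of_scale β (|β + (√(m : ℝ))⁻¹ * ∑ i, Y (x i)|) hs hR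
    have hlt : foldedSurvival β (|β + (√(m : ℝ))⁻¹ * ∑ i, Y (x i)| + ε) < a :=
      ((foldedSurvival_anti β (by linarith)).trans h).trans_lt
        (ENNReal.add_lt_add_right ENNReal.ofReal_ne_top hx)
    exact hlt
  refine (measure_mono hsub).trans ((measure_union_le _ _).trans (add_le_add le_rfl ?_))
  have hmap : (Measure.pi fun _ : Fin m => μ) ((fun x => (√(m : ℝ))⁻¹ * ∑ i, Y (x i)) ⁻¹' B)
      = sumLaw μ Y m B := (Measure.map_apply (measurable_normalizedSum hY m) hBm).symm
  rw [hmap]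
  refine (left_measure_le_of_levyProkhorovEDist_lt hLP hBm).trans (add_le_add ?_ le_rfl)
  rw [ENNReal.toReal_ofReal hε.le]
  have hthick : Metric.thickening ε B ⊆ {t | foldedSurvival β (|β + t| + 2 * ε) < a} := by
    intro t ht
    obtain ⟨t', ht', hd⟩ := Metric.mem_thickening_iff.1 ht
    have h1 : |β + t'| ≤ |β + t| + ε := by
      have e : β + t' = (β + t) - (t - t') := by ring
      rw [e]
      refine (abs_sub _ _).trans ?_
      rw [Real.dist_eq] at hd
      linarith
    exact (foldedSurvival_anti β (by linarith)).trans_lt ht'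
  refine (measure_mono hthick).trans
    ((gaussianReal_foldedSurvival_lt_le β (by linarith) a).trans (le_of_eq ?_))
  congr 2; ring

lemma exists_standardized_noncoverage_le (μ : Measure ℝ) [IsProbabilityMeasure μ] (α : ℝ≥0∞)
    {ε : ℝ} (hε : 0 < ε) :
    ∃ κ > 0, ∃ m₀ : ℕ, ∀ m ≥ m₀, ∀ (Y : ℝ → ℝ) (K β : ℝ), Measurable Y → ∫ x, Y x ∂μ = 0 →
      ∫ x, Y x ^ 2 ∂μ = 1 → (∀ᵐ x ∂μ, |Y x| ≤ K) → K ^ 2 ≤ κ * m →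
      (Measure.pi fun _ : Fin m => μ) {x | gaussianReal 0 1
        {z | |β + (√(m : ℝ))⁻¹ * ∑ i, Y (x i)| ≤ |β + √(m * sampleVariance m Y x) * z|} < α}
      ≤ α + ENNReal.ofReal ε := by
  -- The error terms add up to `8ε'`; the choice of `R` makes `1/R² = ε'`.
  set ε' := ε / 16 with hε'
  have hε'0 : 0 < ε' := by positivity
  set R := 4 / √ε with hRdef
  have hR : 0 < R := by positivity
  have hR2 : 1 / R ^ 2 = ε' := by
    rw [hRdef, div_pow, Real.sq_sqrt hε.le]; rw [hε']; field_simp; norm_num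
  set η := min 1 (ε' / R) with hηdef
  have hη : 0 < η := lt_min one_pos (by positivity)
  have hη1 : η ≤ 1 := min_le_left _ _
  have hηR : η * R ≤ ε' := by
    rw [← le_div_iff₀ hR]; exact min_le_right _ _
  obtain ⟨κ₁, hκ₁, m₁, h₁⟩ := exists_levyProkhorovEDist_sumLaw_lt μ
    (ε := ENNReal.ofReal ε') (ENNReal.ofReal_pos.2 hε'0)
  refine ⟨min κ₁ (ε' * η ^ 2 / 16), lt_min hκ₁ (by positivity),
    max m₁ (⌈4 / (η * min 1 ε')⌉₊), ?_⟩
  intro m hm Y K β hY h0 hY1 hK hKm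
  have hmm : 4 / (η * min 1 ε') ≤ m :=
    (Nat.le_ceil _).trans (by exact_mod_cast (le_max_right _ _).trans hm)
  have hmin : 0 < min 1 ε' := lt_min one_pos hε'0
  have hm4 : 4 ≤ m * (η * min 1 ε') := by rwa [div_le_iff₀ (by positivity)] at hmm
  have hm0 : (0 : ℝ) < m := by
    rcases (Nat.cast_nonneg m : (0 : ℝ) ≤ m).eq_or_lt with h | h
    · rw [← h] at hm4; norm_num at hm4
    · exact h
  have hmη : 4 ≤ m * η := by
    refine hm4.trans ?_
    gcongr
    exact mul_le_of_le_one_right hη.le (min_le_left _ _)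
  have hmηε : 4 ≤ m * η * ε' := by
    refine hm4.trans ?_
    rw [mul_assoc]
    gcongr
    exact min_le_right _ _
  have hLP := h₁ m ((le_max_left _ _).trans hm) Y K hY h0 hY1 hK
    (hKm.trans (by gcongr; exact min_le_left _ _))
  refine (measure_pi_standardized_noncoverage_le μ α hY hη1 hR hε'0 hηR hLP β).trans ?_
  have hfar := measure_pi_sampleVariance_far_le μ hY h0 hY1 hK hη hη1 hmη
  have hb1 : 16 * K ^ 2 / (m * η ^ 2) ≤ ε' := by
    rw [div_le_iff₀ (by positivity)]
    have : K ^ 2 ≤ ε' * η ^ 2 / 16 * m := hKm.trans (by gcongr; exact min_le_right _ _)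
    linarith
  have hb2 : 4 / (m * η) ≤ ε' := by
    rw [div_le_iff₀ (by positivity)]; linarith
  have hfar' := hfar.trans (add_le_add (ENNReal.ofReal_le_ofReal hb1) (ENNReal.ofReal_le_ofReal hb2))
  refine (add_le_add hfar' le_rfl).trans ?_
  rw [hR2]
  calc ENNReal.ofReal ε' + ENNReal.ofReal ε' + (α + ENNReal.ofReal ε' + ENNReal.ofReal (4 * ε')
        + ENNReal.ofReal ε')
      = α + (ENNReal.ofReal ε' + ENNReal.ofReal ε' + ENNReal.ofReal ε' + ENNReal.ofReal (4 * ε')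
        + ENNReal.ofReal ε') := by ring
    _ = α + ENNReal.ofReal (ε' + ε' + ε' + 4 * ε' + ε') := by
      rw [ENNReal.ofReal_add (by positivity) (by positivity),
        ENNReal.ofReal_add (by positivity) (by positivity),
        ENNReal.ofReal_add (by positivity) (by positivity),
        ENNReal.ofReal_add (by positivity) (by positivity)]
    _ ≤ α + ENNReal.ofReal ε := by
      gcongr
      rw [hε']; linarith

/-- The event that the interval `L̂ ± τ` misses the target, where `τ` is the `1 - α` quantile of
`|b + V̂^{1/2} Z|` and `e` is the mean of the weight function `q`. -/
def quantileMiss (α : ℝ≥0∞) (m : ℕ) (q : ℝ → ℝ) (e b : ℝ) : Set (Fin m → ℝ) :=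
  {x | gaussianReal 0 1
    {z | |b + ((1 / (m : ℝ)) * ∑ i, q (x i) - e)| ≤ |b + √(sampleVariance m q x) * z|} < α}

lemma sampleVariance_affine {m : ℕ} (hm : (m : ℝ) ≠ 0) (Y : ℝ → ℝ) (e σ : ℝ) (x : Fin m → ℝ) :
    sampleVariance m (fun y => e + σ * Y y) x = σ ^ 2 * sampleVariance m Y x := by
  unfold sampleVariance
  have h1 : ∑ i, (e + σ * Y (x i)) = m * e + σ * ∑ i, Y (x i) := by
    rw [Finset.sum_add_distrib, ← Finset.mul_sum]; simp
  have h2 : ∑ i, (e + σ * Y (x i)) ^ 2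
      = m * e ^ 2 + 2 * e * σ * ∑ i, Y (x i) + σ ^ 2 * ∑ i, Y (x i) ^ 2 := by
    have : ∀ i, (e + σ * Y (x i)) ^ 2
        = e ^ 2 + 2 * e * σ * Y (x i) + σ ^ 2 * Y (x i) ^ 2 := fun i => by ring
    simp only [this]
    rw [Finset.sum_add_distrib, Finset.sum_add_distrib, ← Finset.mul_sum, ← Finset.mul_sum]; simp
  rw [h1, h2]
  field_simp
  ring

/-- The miss event is invariant under rescaling. Dividing by `σ/√m` reduces to the standardized case
with bias `b√m/σ`, which may be arbitrarily large; hence the need for uniformity in `β`. -/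
lemma exists_measure_quantileMiss_le (μ : Measure ℝ) [IsProbabilityMeasure μ] (α : ℝ≥0∞)
    {ε : ℝ} (hε : 0 < ε) :
    ∃ κ > 0, ∃ m₀ : ℕ, ∀ m ≥ m₀, ∀ (q : ℝ → ℝ) (K e b σ : ℝ), Measurable q → 0 < σ →
      ∫ x, (q x - e) ∂μ = 0 → ∫ x, (q x - e) ^ 2 ∂μ = σ ^ 2 →
      (∀ᵐ x ∂μ, |q x - e| ≤ K) → K ^ 2 ≤ κ * (m * σ ^ 2) →
      (Measure.pi fun _ : Fin m => μ) (quantileMiss α m q e b) ≤ α + ENNReal.ofReal ε := by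
  obtain ⟨κ, hκ, m₀, h⟩ := exists_standardized_noncoverage_le μ α hε
  refine ⟨κ, hκ, max m₀ 1, ?_⟩
  intro m hm q K e b σ hq hσ h0 h1 hK hKm
  have hm0 : (0 : ℝ) < m := by exact_mod_cast (le_max_right _ _).trans hm
  have hs : 0 < √(m : ℝ) := Real.sqrt_pos.2 hm0
  set Y : ℝ → ℝ := fun x => (q x - e) / σ with hYdef
  set r := σ / √(m : ℝ) with hr
  have hr0 : 0 < r := by positivity
  have hqY : q = fun x => e + σ * Y x := by
    ext x; rw [hYdef]; field_simp; ring
  have hh := h m ((le_max_left _ _).trans hm) Y (K / σ) (b / r) (by fun_prop)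
    (by simp only [hYdef]; rw [integral_div, h0, zero_div])
    (by
      simp only [hYdef, div_pow]
      rw [integral_div, h1, div_self (by positivity)])
    (by
      filter_upwards [hK] with x hx
      rw [hYdef, abs_div, abs_of_pos hσ]
      gcongr)
    (by
      rw [div_pow, div_le_iff₀ (by positivity)]
      linarith)
  refine (measure_mono ?_).trans hh
  intro x hx
  have key : {z : ℝ | |b + ((1 / (m : ℝ)) * ∑ i, q (x i) - e)|
        ≤ |b + √(sampleVariance m q x) * z|}
      = {z | |b / r + (√(m : ℝ))⁻¹ * ∑ i, Y (x i)|
        ≤ |b / r + √(m * sampleVariance m Y x) * z|} := by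
    have e1 : b + ((1 / (m : ℝ)) * ∑ i, q (x i) - e)
        = r * (b / r + (√(m : ℝ))⁻¹ * ∑ i, Y (x i)) := by
      have hsum : ∑ i, q (x i) = m * e + σ * ∑ i, Y (x i) := by
        rw [hqY, Finset.sum_add_distrib, ← Finset.mul_sum]; simp
      rw [hsum, mul_add r, mul_div_cancel₀ _ hr0.ne', hr]
      have : σ / √(m : ℝ) * ((√(m : ℝ))⁻¹ * ∑ i, Y (x i)) = σ * (∑ i, Y (x i)) / m := by
        rw [← Real.sq_sqrt hm0.le]
        rw [Real.sqrt_sq hs.le]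
        field_simp
      rw [this]; field_simp; ring
    have e2 : √(sampleVariance m q x) = r * √(m * sampleVariance m Y x) := by
      have : sampleVariance m q x = r ^ 2 * (m * sampleVariance m Y x) := by
        conv_lhs => rw [hqY]
        rw [sampleVariance_affine hm0.ne', hr, div_pow, Real.sq_sqrt hm0.le]
        field_simp
      rw [this, Real.sqrt_mul (by positivity), Real.sqrt_sq hr0.le]
    ext z
    have e3 : b + √(sampleVariance m q x) * z
        = r * (b / r + √(m * sampleVariance m Y x) * z) := by
      rw [e2, mul_add r, mul_div_cancel₀ _ hr0.ne']; ring
    rw [Set.mem_ofPred_eq, Set.mem_ofPred_eq, e1, e3, abs_mul, abs_mul, abs_of_pos hr0]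
    exact mul_le_mul_iff_right₀ hr0
  have hx' : gaussianReal 0 1 {z : ℝ | |b + ((1 / (m : ℝ)) * ∑ i, q (x i) - e)|
        ≤ |b + √(sampleVariance m q x) * z|} < α := hx
  rw [key] at hx'
  exact hx'

end Coverage

/-! ### The modulus problem in an inner product space -/

section AbstractModulus

/-- The right derivative is a supergradient: it lies below the slopes to the left of `δ` and above
those to the right. -/
lemma superdifferential_nonempty {w : ℝ → ℝ} (hw : ConcaveOn ℝ (Set.Ioi 0) w) {δ : ℝ}
    (hδ : 0 < δ) : (superdifferential w δ).Nonempty := by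
  have hc : ConvexOn ℝ (Set.Ioi 0) (-w) := hw.neg
  have hint : δ ∈ interior (Set.Ioi (0 : ℝ)) := by rw [interior_Ioi]; exact hδ
  refine ⟨-derivWithin (-w) (Set.Ioi δ) δ, fun δ' hδ' => ?_⟩
  rcases lt_trichotomy δ δ' with h | h | h
  · have := hc.rightDeriv_le_slope_of_mem_interior hint hδ' h
    rw [slope_def_field, le_div_iff₀ (by linarith)] at this
    simp only [Pi.neg_apply] at this
    linarith
  · subst h; simp
  · have h1 := hc.slope_le_leftDeriv_of_mem_interior hδ' hint h
    have h2 := h1.trans (hc.leftDeriv_le_rightDeriv_of_mem_interior hint)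
    rw [slope_def_field, div_le_iff₀ (by linarith)] at h2
    simp only [Pi.neg_apply] at h2
    linarith

variable {V : Type*} [NormedAddCommGroup V]

/-- The modulus of continuity of `(v, ℓ) ↦ ℓ` with respect to `‖v‖` over the set `C`. -/
noncomputable def abstractModulus {V : Type*} [NormedAddCommGroup V] (C : Set (V × ℝ)) (δ : ℝ) : ℝ :=
  sSup {ℓ | ∃ v, (v, ℓ) ∈ C ∧ ‖v‖ ≤ δ}

variable {C : Set (V × ℝ)}

lemma abstractModulus_bddAbove (hb : BddAbove (Prod.snd '' C)) (δ : ℝ) :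
    BddAbove {ℓ | ∃ v, (v, ℓ) ∈ C ∧ ‖v‖ ≤ δ} :=
  hb.mono <| by rintro ℓ ⟨v, hv, _⟩; exact ⟨(v, ℓ), hv, rfl⟩

lemma le_abstractModulus (hb : BddAbove (Prod.snd '' C)) {v : V} {ℓ δ : ℝ} (h : (v, ℓ) ∈ C)
    (hv : ‖v‖ ≤ δ) : ℓ ≤ abstractModulus C δ :=
  le_csSup (abstractModulus_bddAbove hb δ) ⟨v, h, hv⟩

lemma nonneg_of_mem_superdifferential_abstractModulus (hb : BddAbove (Prod.snd '' C)) (h0 : ((0 : V), (0 : ℝ)) ∈ C)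
    {δ s : ℝ} (hδ : 0 < δ) (hs : s ∈ superdifferential (abstractModulus C) δ) : 0 ≤ s := by
  have h1 := hs (δ + 1) (by linarith)
  have h2 : abstractModulus C δ ≤ abstractModulus C (δ + 1) := by
    refine csSup_le_csSup (abstractModulus_bddAbove hb _) ⟨0, 0, h0, by simpa using hδ.le⟩ ?_
    rintro ℓ ⟨v, hv, hn⟩
    exact ⟨v, hv, by linarith⟩
  linarith

variable [InnerProductSpace ℝ V]

/-- Mixtures of admissible pairs are admissible at the mixed radius. The two suprema are passed to
one at a time; a zero weight is separated because each passage divides by the weight. -/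
lemma abstractModulus_concaveOn (hC : Convex ℝ C) (hb : BddAbove (Prod.snd '' C))
    (h0 : ((0 : V), (0 : ℝ)) ∈ C) : ConcaveOn ℝ (Set.Ioi 0) (abstractModulus C) := by
  refine ⟨convex_Ioi 0, fun x hx y hy a b ha hbb hab => ?_⟩
  have hne : ∀ z ∈ Set.Ioi (0 : ℝ), {ℓ | ∃ v, (v, ℓ) ∈ C ∧ ‖v‖ ≤ z}.Nonempty := fun z hz =>
    ⟨0, 0, h0, by rw [norm_zero]; exact le_of_lt hz⟩
  simp only [smul_eq_mul]
  have key : ∀ ℓ₁ ∈ {ℓ | ∃ v, (v, ℓ) ∈ C ∧ ‖v‖ ≤ x}, ∀ ℓ₂ ∈ {ℓ | ∃ v, (v, ℓ) ∈ C ∧ ‖v‖ ≤ y},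
      a * ℓ₁ + b * ℓ₂ ≤ abstractModulus C (a * x + b * y) := by
    rintro ℓ₁ ⟨v₁, h₁, n₁⟩ ℓ₂ ⟨v₂, h₂, n₂⟩
    refine le_abstractModulus hb (v := a • v₁ + b • v₂) (hC h₁ h₂ ha hbb hab) ?_
    refine (norm_add_le _ _).trans ?_
    rw [norm_smul, norm_smul, Real.norm_of_nonneg ha, Real.norm_of_nonneg hbb]
    gcongr
  have step : ∀ ℓ₁ ∈ {ℓ | ∃ v, (v, ℓ) ∈ C ∧ ‖v‖ ≤ x},
      a * ℓ₁ + b * abstractModulus C y ≤ abstractModulus C (a * x + b * y) := by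
    intro ℓ₁ h₁
    rcases hbb.eq_or_lt with h | h
    · obtain ⟨ℓ₂, h₂⟩ := hne y hy
      have := key ℓ₁ h₁ ℓ₂ h₂
      rw [← h] at this ⊢
      simpa using this
    · have : abstractModulus C y ≤ (abstractModulus C (a * x + b * y) - a * ℓ₁) / b :=
        csSup_le (hne y hy) fun ℓ₂ h₂ => by
          rw [le_div_iff₀ h]; linarith [key ℓ₁ h₁ ℓ₂ h₂]
      rw [le_div_iff₀ h] at this; linarith
  rcases ha.eq_or_lt with h | h
  · obtain ⟨ℓ₁, h₁⟩ := hne x hx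
    have := step ℓ₁ h₁
    rw [← h] at this ⊢
    simpa using this
  · have : abstractModulus C x
        ≤ (abstractModulus C (a * x + b * y) - b * abstractModulus C y) / a :=
      csSup_le (hne x hx) fun ℓ₁ h₁ => by
        rw [le_div_iff₀ h]; linarith [step ℓ₁ h₁]
    rw [le_div_iff₀ h] at this; linarith

/-- First-order optimality of a solution of the modulus problem. -/
lemma sub_inner_le_of_attained (hC : Convex ℝ C) (hb : BddAbove (Prod.snd '' C))
    {δ s : ℝ} (hδ : 0 < δ) (hs : s ∈ superdifferential (abstractModulus C) δ)
    {v₀ : V} (h₀ : (v₀, abstractModulus C δ) ∈ C) (hv₀ : ‖v₀‖ ≤ δ)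
    {v : V} {ℓ : ℝ} (h : (v, ℓ) ∈ C) :
    ℓ - s / δ * inner ℝ v₀ v ≤ abstractModulus C δ - s * δ := by
  set ω := abstractModulus C δ with hω
  set A := inner ℝ v₀ v
  -- Move a fraction `ε` of the way from the solution to `(v, ℓ)`, compare with the supergradient
  -- line, and divide by `ε`.
  have key : ∀ ε : ℝ, 0 < ε → ε < 1 →
      ℓ - ω ≤ s / (2 * δ) * (2 * (A - δ ^ 2) + ε * (δ ^ 2 - 2 * A + ‖v‖ ^ 2)) := by
    intro ε h0 h1
    set D := (1 - ε) • v₀ + ε • v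
    set T := (1 - ε) ^ 2 * δ ^ 2 + 2 * ε * (1 - ε) * A + ε ^ 2 * ‖v‖ ^ 2 with hT
    have hn : ‖D‖ ^ 2 ≤ T := by
      have : ‖D‖ ^ 2 = (1 - ε) ^ 2 * ‖v₀‖ ^ 2 + 2 * ε * (1 - ε) * A + ε ^ 2 * ‖v‖ ^ 2 := by
        rw [norm_add_sq_real, norm_smul, norm_smul, inner_smul_left, inner_smul_right,
          mul_pow, mul_pow, Real.norm_eq_abs, Real.norm_eq_abs, sq_abs, sq_abs]
        simp only [conj_trivial]
        ring
      rw [this, hT]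
      have := pow_le_pow_left₀ (norm_nonneg _) hv₀ 2
      gcongr
    have hmem : (D, (1 - ε) * ω + ε * ℓ) ∈ C := by
      have := hC h₀ h (by linarith : (0 : ℝ) ≤ 1 - ε) h0.le (by ring)
      simpa [D, smul_eq_mul] using this
    have hTpos : 0 ≤ T := (sq_nonneg _).trans hn
    have hle : ∀ d > 0, T ≤ d ^ 2 → (1 - ε) * ω + ε * ℓ ≤ ω + s * (d - δ) := by
      intro d hd hTd
      refine (le_abstractModulus hb hmem ?_).trans (hs d hd)
      exact le_of_sq_le_sq (hn.trans hTd) hd.le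
    have hsq : (1 - ε) * ω + ε * ℓ ≤ ω + s * ((T - δ ^ 2) / (2 * δ)) := by
      -- This radius dominates `√T` by the arithmetic-geometric mean inequality. Unlike `√T` it is
      -- positive even if `T = 0`, and it is polynomial in `ε`.
      have hd : 0 < (T + δ ^ 2) / (2 * δ) := by positivity
      have := hle _ hd (by
        rw [div_pow, le_div_iff₀ (by positivity)]
        nlinarith [sq_nonneg (T - δ ^ 2)])
      refine this.trans (le_of_eq ?_)
      congr 2
      field_simp
      ring
    have e : s * ((T - δ ^ 2) / (2 * δ))
        = ε * (s / (2 * δ) * (2 * (A - δ ^ 2) + ε * (δ ^ 2 - 2 * A + ‖v‖ ^ 2))) := by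
      rw [hT]; field_simp; ring
    rw [e] at hsq
    have : ε * (ℓ - ω)
        ≤ ε * (s / (2 * δ) * (2 * (A - δ ^ 2) + ε * (δ ^ 2 - 2 * A + ‖v‖ ^ 2))) := by linarith
    exact le_of_mul_le_mul_left this h0
  have hlim : Tendsto (fun ε : ℝ => s / (2 * δ) * (2 * (A - δ ^ 2)
      + ε * (δ ^ 2 - 2 * A + ‖v‖ ^ 2))) (𝓝[>] 0) (𝓝 (s / (2 * δ) * (2 * (A - δ ^ 2)))) := by
    have : Continuous fun ε : ℝ => s / (2 * δ) * (2 * (A - δ ^ 2)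
      + ε * (δ ^ 2 - 2 * A + ‖v‖ ^ 2)) := by fun_prop
    have h := this.tendsto 0
    simp only [zero_mul, add_zero] at h
    exact h.mono_left nhdsWithin_le_nhds
  have hfin := ge_of_tendsto hlim (by
    filter_upwards [Ioo_mem_nhdsGT (zero_lt_one (α := ℝ))] with ε hε
    exact key ε hε.1 hε.2)
  have e : s / (2 * δ) * (2 * (A - δ ^ 2)) = s / δ * A - s * δ := by field_simp
  linarith

/-- The equality case of the Cauchy–Schwarz inequality which identifies the minimax weights. -/
lemma eq_smul_of_inner_ge {q v₀ : V} {s δ : ℝ} (hδ : 0 < δ) (hs0 : 0 ≤ s) (hq : ‖q‖ ≤ s)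
    (hv₀ : ‖v₀‖ ≤ δ) (h : s * δ ≤ inner ℝ q v₀) : q = (s / δ) • v₀ := by
  have h0 : ‖q - (s / δ) • v₀‖ ^ 2 ≤ 0 := by
    rw [norm_sub_sq_real, inner_smul_right, norm_smul, mul_pow, Real.norm_eq_abs, sq_abs]
    have h1 : ‖q‖ ^ 2 ≤ s ^ 2 := pow_le_pow_left₀ (norm_nonneg _) hq 2
    have h2 : ‖v₀‖ ^ 2 ≤ δ ^ 2 := pow_le_pow_left₀ (norm_nonneg _) hv₀ 2
    have h3 : (s / δ) ^ 2 * ‖v₀‖ ^ 2 ≤ s ^ 2 := by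
      calc (s / δ) ^ 2 * ‖v₀‖ ^ 2 ≤ (s / δ) ^ 2 * δ ^ 2 := by gcongr
        _ = s ^ 2 := by field_simp
    have h4 : s ^ 2 ≤ s / δ * inner ℝ q v₀ := by
      calc s ^ 2 = s / δ * (s * δ) := by field_simp
        _ ≤ _ := by gcongr
    linarith
  have : ‖q - (s / δ) • v₀‖ = 0 := by
    have := le_antisymm h0 (sq_nonneg _)
    exact pow_eq_zero_iff (two_ne_zero) |>.1 this
  exact sub_eq_zero.1 (norm_eq_zero.1 this)

end AbstractModulus

/-! ### Gaussian mixture densities -/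

section MarginalDensity

lemma continuous_gaussianPDFReal_std : Continuous (gaussianPDFReal 0 1) := by
  unfold gaussianPDFReal
  fun_prop

lemma norm_gaussianPDFReal_std_le (x : ℝ) : ‖gaussianPDFReal 0 1 x‖ ≤ 1 := by
  rw [Real.norm_of_nonneg (gaussianPDFReal_nonneg _ _ _)]
  exact gaussianPDFReal_std_le_one x

variable (H : Measure ℝ)

lemma marginalDensity_nonneg (x : ℝ) : 0 ≤ marginalDensity H x :=
  integral_nonneg fun _ => gaussianPDFReal_nonneg _ _ _

lemma integrable_gaussianPDFReal_sub [IsFiniteMeasure H] (x : ℝ) :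
    Integrable (fun u => gaussianPDFReal 0 1 (x - u)) H :=
  Integrable.of_bound ((measurable_gaussianPDFReal 0 1).comp
    (measurable_const.sub measurable_id)).aestronglyMeasurable 1
    (ae_of_all _ fun _ => norm_gaussianPDFReal_std_le _)

lemma continuous_marginalDensity [IsFiniteMeasure H] : Continuous (marginalDensity H) := by
  unfold marginalDensity
  refine continuous_of_dominated (bound := fun _ => 1)
    (fun x => (integrable_gaussianPDFReal_sub H x).aestronglyMeasurable)
    (fun x => ae_of_all _ fun _ => norm_gaussianPDFReal_std_le _) (integrable_const _)
    (ae_of_all _ fun u => ?_)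
  have := continuous_gaussianPDFReal_std
  fun_prop

lemma marginalDensity_pos [IsProbabilityMeasure H] (x : ℝ) : 0 < marginalDensity H x := by
  unfold marginalDensity
  rw [integral_pos_iff_support_of_nonneg (fun _ => gaussianPDFReal_nonneg _ _ _)
    (integrable_gaussianPDFReal_sub H x)]
  have : Function.support (fun u => gaussianPDFReal 0 1 (x - u)) = Set.univ :=
    Set.eq_univ_of_forall fun u => (gaussianPDFReal_pos _ _ _ one_ne_zero).ne'
  rw [this, measure_univ]
  exact one_pos

lemma lintegral_marginalDensity [IsProbabilityMeasure H] :
    ∫⁻ x, ENNReal.ofReal (marginalDensity H x) = 1 := by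
  have h1 : ∀ x, ENNReal.ofReal (marginalDensity H x)
      = ∫⁻ u, ENNReal.ofReal (gaussianPDFReal 0 1 (x - u)) ∂H := fun x =>
    ofReal_integral_eq_lintegral_ofReal (integrable_gaussianPDFReal_sub H x)
      (ae_of_all _ fun _ => gaussianPDFReal_nonneg _ _ _)
  simp only [h1]
  have hm : Measurable (Function.uncurry fun x u : ℝ =>
      ENNReal.ofReal (gaussianPDFReal 0 1 (x - u))) :=
    ((measurable_gaussianPDFReal 0 1).comp (measurable_fst.sub measurable_snd)).ennreal_ofReal
  rw [lintegral_lintegral_swap hm.aemeasurable]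
  have h2 : ∀ u : ℝ, ∫⁻ x, ENNReal.ofReal (gaussianPDFReal 0 1 (x - u)) = 1 := fun u => by
    rw [lintegral_sub_right_eq_self (fun x => ENNReal.ofReal (gaussianPDFReal 0 1 x)) u]
    exact lintegral_gaussianPDFReal_eq_one 0 one_ne_zero
  simp [h2]

lemma integrable_marginalDensity [IsProbabilityMeasure H] : Integrable (marginalDensity H) := by
  refine ⟨(continuous_marginalDensity H).aestronglyMeasurable, ?_⟩
  rw [hasFiniteIntegral_iff_ofReal (ae_of_all _ (marginalDensity_nonneg H)),
    lintegral_marginalDensity]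
  exact ENNReal.one_lt_top

instance isProbabilityMeasure_marginal [IsProbabilityMeasure H] :
    IsProbabilityMeasure (marginal H) := by
  refine ⟨?_⟩
  rw [marginal, withDensity_apply _ MeasurableSet.univ, setLIntegral_univ,
    lintegral_marginalDensity]

lemma integral_marginalDensity [IsProbabilityMeasure H] : ∫ x, marginalDensity H x = 1 := by
  rw [integral_eq_lintegral_of_nonneg_ae (ae_of_all _ (marginalDensity_nonneg H))
    (continuous_marginalDensity H).aestronglyMeasurable, lintegral_marginalDensity]
  simp

lemma marginalDensity_combination (H₁ H₂ : Measure ℝ) [IsProbabilityMeasure H₁]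
    [IsProbabilityMeasure H₂] (a b : ℝ≥0) (x : ℝ) :
    marginalDensity (a • H₁ + b • H₂) x
      = a * marginalDensity H₁ x + b * marginalDensity H₂ x := by
  unfold marginalDensity
  rw [integral_add_measure ((integrable_gaussianPDFReal_sub H₁ x).smul_measure_nnreal)
    ((integrable_gaussianPDFReal_sub H₂ x).smul_measure_nnreal), integral_smul_nnreal_measure,
    integral_smul_nnreal_measure]
  simp [NNReal.smul_def]

lemma linFun_combination {ψ : ℝ → ℝ} {H₁ H₂ : Measure ℝ} (h₁ : Integrable ψ H₁)
    (h₂ : Integrable ψ H₂) (a b : ℝ≥0) :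
    linFun ψ (a • H₁ + b • H₂) = a * linFun ψ H₁ + b * linFun ψ H₂ := by
  unfold linFun
  rw [integral_add_measure h₁.smul_measure_nnreal h₂.smul_measure_nnreal,
    integral_smul_nnreal_measure, integral_smul_nnreal_measure]
  simp [NNReal.smul_def]

lemma exists_marginalDensity_lower_bound [IsProbabilityMeasure H] {M : ℝ} (hM : 0 < M) :
    ∃ η > 0, (∀ x ∈ Set.Icc (-M) M, η ≤ marginalDensity H x) ∧
      η ≤ ∫ x in Set.Iic (-M), marginalDensity H x ∧
      η ≤ ∫ x in Set.Ici M, marginalDensity H x := by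
  have hpos : ∀ s : Set ℝ, volume s ≠ 0 → 0 < ∫ x in s, marginalDensity H x := by
    intro s hs
    rw [integral_pos_iff_support_of_nonneg (marginalDensity_nonneg H)
      (integrable_marginalDensity H).integrableOn]
    have : Function.support (marginalDensity H) = Set.univ :=
      Set.eq_univ_of_forall fun u => (marginalDensity_pos H u).ne'
    rw [this, Measure.restrict_apply_univ]
    exact pos_iff_ne_zero.2 hs
  obtain ⟨x₀, hx₀, hmin⟩ := isCompact_Icc.exists_isMinOn (Set.nonempty_Icc.2 (by linarith : -M ≤ M))
    (continuous_marginalDensity H).continuousOn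
  refine ⟨min (marginalDensity H x₀) (min (∫ x in Set.Iic (-M), marginalDensity H x)
    (∫ x in Set.Ici M, marginalDensity H x)), lt_min (marginalDensity_pos H x₀)
    (lt_min (hpos _ (by simp)) (hpos _ (by simp))), fun x hx => (min_le_left _ _).trans (hmin hx),
    (min_le_right _ _).trans (min_le_left _ _), (min_le_right _ _).trans (min_le_right _ _)⟩

end MarginalDensity

/-! ### Integrals against measures with a density -/

section WithDensity

lemma integral_withDensity_ofReal {p : ℝ → ℝ} (hp : Measurable p) (hp0 : ∀ x, 0 ≤ p x)
    (u : ℝ → ℝ) :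
    ∫ x, u x ∂(volume.withDensity fun x => ENNReal.ofReal (p x)) = ∫ x, u x * p x := by
  rw [integral_withDensity_eq_integral_toReal_smul hp.ennreal_ofReal
    (ae_of_all _ fun _ => ENNReal.ofReal_lt_top)]
  refine integral_congr_ae (ae_of_all _ fun x => ?_)
  simp only [smul_eq_mul, ENNReal.toReal_ofReal (hp0 x)]
  ring

lemma integrable_withDensity_ofReal {p : ℝ → ℝ} (hp : Measurable p) (hp0 : ∀ x, 0 ≤ p x)
    (u : ℝ → ℝ) :
    Integrable u (volume.withDensity fun x => ENNReal.ofReal (p x))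
      ↔ Integrable fun x => u x * p x := by
  rw [integrable_withDensity_iff_integrable_smul' hp.ennreal_ofReal
    (ae_of_all _ fun _ => ENNReal.ofReal_lt_top)]
  refine integrable_congr (ae_of_all _ fun x => ?_)
  simp only [smul_eq_mul, ENNReal.toReal_ofReal (hp0 x)]
  ring

end WithDensity

section BandNorm

lemma bandNorm_le_iff {M : ℝ} {h : ℝ → ℝ} {c : ℝ≥0} :
    bandNorm M h ≤ (c : ℝ≥0∞) ↔ (∀ x ∈ Set.Icc (-M) M, |h x| ≤ c) ∧
      |∫ x in Set.Iic (-M), h x| ≤ c ∧ |∫ x in Set.Ici M, h x| ≤ c := by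
  have key : ∀ r : ℝ, ENNReal.ofReal r ≤ (c : ℝ≥0∞) ↔ r ≤ c := fun r => by
    rw [← ENNReal.ofReal_coe_nnreal, ENNReal.ofReal_le_ofReal_iff c.coe_nonneg]
  unfold bandNorm
  rw [max_le_iff, max_le_iff, iSup₂_le_iff, key, key]
  simp only [key]

end BandNorm

/-! ### Collapsing the tails to points -/

section Bins

/-- `Q` is constant on each of the two tails. -/
def TailConst (M : ℝ) (Q : ℝ → ℝ) : Prop :=
  (∃ q, ∀ x ≤ -M, Q x = q) ∧ ∃ q, ∀ x ≥ M, Q x = q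

lemma TailConst.comp₂ {M : ℝ} {Q R : ℝ → ℝ} (hQ : TailConst M Q) (hR : TailConst M R)
    (F : ℝ → ℝ → ℝ) : TailConst M fun x => F (Q x) (R x) := by
  obtain ⟨⟨a, ha⟩, b, hb⟩ := hQ
  obtain ⟨⟨a', ha'⟩, b', hb'⟩ := hR
  exact ⟨⟨F a a', fun x hx => by simp only [ha x hx, ha' x hx]⟩,
    F b b', fun x hx => by simp only [hb x hx, hb' x hx]⟩

/-- Integrable functions which coincide after the two tails are collapsed to points. -/
structure BinEquiv (M : ℝ) (h₁ h₂ : ℝ → ℝ) : Prop where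
  left_integrable : Integrable h₁
  right_integrable : Integrable h₂
  lower : ∫ x in Set.Iic (-M), h₁ x = ∫ x in Set.Iic (-M), h₂ x
  upper : ∫ x in Set.Ici M, h₁ x = ∫ x in Set.Ici M, h₂ x
  middle : ∀ᵐ x, x ∈ Set.Ioo (-M) M → h₁ x = h₂ x

lemma BinEquiv.symm {M : ℝ} {h₁ h₂ : ℝ → ℝ} (h : BinEquiv M h₁ h₂) : BinEquiv M h₂ h₁ :=
  ⟨h.2, h.1, h.3.symm, h.4.symm, by filter_upwards [h.5] with x hx hm using (hx hm).symm⟩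

variable {M : ℝ}

lemma union_bins (hM : 0 < M) : Set.Iic (-M) ∪ (Set.Ioo (-M) M ∪ Set.Ici M) = Set.univ := by
  rw [Set.Ioo_union_Ici_eq_Ioi (by linarith), Set.Iic_union_Ioi]

lemma integrable_iff_bins (hM : 0 < M) {u : ℝ → ℝ} :
    Integrable u ↔ IntegrableOn u (Set.Iic (-M)) ∧ IntegrableOn u (Set.Ioo (-M) M) ∧
      IntegrableOn u (Set.Ici M) := by
  rw [← integrableOn_univ, ← union_bins hM, integrableOn_union, integrableOn_union]

lemma integral_eq_bins (hM : 0 < M) {u : ℝ → ℝ} (hu : Integrable u) :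
    ∫ x, u x = (∫ x in Set.Iic (-M), u x) + (∫ x in Set.Ioo (-M) M, u x)
      + ∫ x in Set.Ici M, u x := by
  rw [← setIntegral_univ, ← union_bins hM, setIntegral_union _ (by measurability)
    hu.integrableOn hu.integrableOn, setIntegral_union _ (by measurability)
    hu.integrableOn hu.integrableOn, add_assoc]
  · exact Set.disjoint_left.2 fun x hx hx' => (not_le.2 hx.2) hx'
  · refine Set.disjoint_left.2 fun x hx hx' => ?_
    rcases hx' with h | h
    · exact (not_lt.2 hx) h.1
    · have h1 : x ≤ -M := hx
      have h2 : M ≤ x := h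
      linarith

lemma BinEquiv.integrable_mul (hM : 0 < M) {h₁ h₂ Q : ℝ → ℝ} (h : BinEquiv M h₁ h₂)
    (hQ : TailConst M Q) (hi : Integrable fun x => Q x * h₁ x) :
    Integrable fun x => Q x * h₂ x := by
  obtain ⟨⟨a, ha⟩, b, hb⟩ := hQ
  rw [integrable_iff_bins hM] at hi ⊢
  refine ⟨?_, ?_, ?_⟩
  · refine IntegrableOn.congr_fun (f := fun x => a * h₂ x)
      (h.right_integrable.integrableOn.const_mul a) (fun x hx => ?_) measurableSet_Iic
    simp only [ha x hx]
  · refine Integrable.congr hi.2.1 ?_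
    filter_upwards [ae_restrict_mem measurableSet_Ioo, ae_restrict_of_ae h.middle] with x hx hx'
    rw [hx' hx]
  · refine IntegrableOn.congr_fun (f := fun x => b * h₂ x)
      (h.right_integrable.integrableOn.const_mul b) (fun x hx => ?_) measurableSet_Ici
    simp only [hb x hx]

/-- A tail-constant `Q` sees a function on each tail only through its integral there. This allows a
pilot that is negative in places on the tails to be exchanged for a positive weight. -/
lemma BinEquiv.integral_mul_eq (hM : 0 < M) {h₁ h₂ Q : ℝ → ℝ} (h : BinEquiv M h₁ h₂)
    (hQ : TailConst M Q) (hi : Integrable fun x => Q x * h₁ x) :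
    ∫ x, Q x * h₁ x = ∫ x, Q x * h₂ x := by
  rw [integral_eq_bins hM hi, integral_eq_bins hM (h.integrable_mul hM hQ hi)]
  obtain ⟨⟨a, ha⟩, b, hb⟩ := hQ
  have hl : ∀ u : ℝ → ℝ, ∫ x in Set.Iic (-M), Q x * u x = a * ∫ x in Set.Iic (-M), u x := by
    intro u
    rw [← integral_const_mul]
    exact setIntegral_congr_fun measurableSet_Iic fun x hx => by simp only [ha x hx]
  have hr : ∀ u : ℝ → ℝ, ∫ x in Set.Ici M, Q x * u x = b * ∫ x in Set.Ici M, u x := by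
    intro u
    rw [← integral_const_mul]
    exact setIntegral_congr_fun measurableSet_Ici fun x hx => by simp only [hb x hx]
  have hm : ∫ x in Set.Ioo (-M) M, Q x * h₁ x = ∫ x in Set.Ioo (-M) M, Q x * h₂ x := by
    refine integral_congr_ae ?_
    filter_upwards [ae_restrict_mem measurableSet_Ioo, ae_restrict_of_ae h.middle] with x hx hx'
    rw [hx' hx]
  rw [hl, hl, hr, hr, hm, h.lower, h.upper]

/-- The density of `h` with respect to `w` after the tails are collapsed to points. -/
noncomputable def binRatio (M : ℝ) (w h : ℝ → ℝ) (x : ℝ) : ℝ :=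
  if x ≤ -M then (∫ y in Set.Iic (-M), h y) / ∫ y in Set.Iic (-M), w y
  else if M ≤ x then (∫ y in Set.Ici M, h y) / ∫ y in Set.Ici M, w y
  else h x / w x

lemma tailConst_binRatio (hM : 0 < M) (w h : ℝ → ℝ) : TailConst M (binRatio M w h) := by
  refine ⟨⟨(∫ y in Set.Iic (-M), h y) / ∫ y in Set.Iic (-M), w y, fun x hx => ?_⟩,
    ⟨(∫ y in Set.Ici M, h y) / ∫ y in Set.Ici M, w y, fun x hx => ?_⟩⟩
  · simp [binRatio, hx]
  · have : ¬ x ≤ -M := by linarith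
    have hx' : M ≤ x := hx
    simp [binRatio, this, hx']

lemma binRatio_lower (w h : ℝ → ℝ) {x : ℝ} (hx : x ≤ -M) :
    binRatio M w h x = (∫ y in Set.Iic (-M), h y) / ∫ y in Set.Iic (-M), w y := by
  simp [binRatio, hx]

lemma binRatio_upper (hM : 0 < M) (w h : ℝ → ℝ) {x : ℝ} (hx : M ≤ x) :
    binRatio M w h x = (∫ y in Set.Ici M, h y) / ∫ y in Set.Ici M, w y := by
  have : ¬ x ≤ -M := by linarith
  simp [binRatio, this, hx]

lemma binRatio_middle (w h : ℝ → ℝ) {x : ℝ} (hx : x ∈ Set.Ioo (-M) M) :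
    binRatio M w h x = h x / w x := by
  have h1 : ¬ x ≤ -M := not_le.2 hx.1
  have h2 : ¬ M ≤ x := not_le.2 hx.2
  simp [binRatio, h1, h2]

lemma measurable_binRatio {w h : ℝ → ℝ} (hw : Measurable w) (hh : Measurable h) :
    Measurable (binRatio M w h) :=
  Measurable.ite measurableSet_Iic measurable_const
    (Measurable.ite measurableSet_Ici measurable_const (hh.div hw))

/-- The three terms of the band norm control the numerators of the three branches, and `η` bounds
the denominators from below. -/
lemma abs_binRatio_le (hM : 0 < M) {w h : ℝ → ℝ} {c : ℝ≥0} {η : ℝ} (hη : 0 < η)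
    (hb : bandNorm M h ≤ c) (hw : ∀ x ∈ Set.Icc (-M) M, η ≤ w x)
    (hl : η ≤ ∫ x in Set.Iic (-M), w x) (hu : η ≤ ∫ x in Set.Ici M, w x) (x : ℝ) :
    |binRatio M w h x| ≤ c / η := by
  rw [bandNorm_le_iff] at hb
  have key : ∀ a b : ℝ, |a| ≤ c → η ≤ b → |a / b| ≤ c / η := by
    intro a b ha hab
    rw [abs_div, abs_of_pos (hη.trans_le hab)]
    exact div_le_div₀ c.coe_nonneg ha hη hab
  by_cases h1 : x ≤ -M
  · rw [binRatio_lower _ _ h1]; exact key _ _ hb.2.1 hl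
  by_cases h2 : M ≤ x
  · rw [binRatio_upper hM _ _ h2]; exact key _ _ hb.2.2 hu
  rw [not_le] at h1 h2
  rw [binRatio_middle _ _ ⟨h1, h2⟩]
  exact key _ _ (hb.1 x ⟨h1.le, h2.le⟩) (hw x ⟨h1.le, h2.le⟩)

lemma binEquiv_binRatio_mul (hM : 0 < M) {w h : ℝ → ℝ} (hw : Integrable w) (hh : Integrable h)
    (hwpos : ∀ x ∈ Set.Ioo (-M) M, w x ≠ 0) (hl : ∫ x in Set.Iic (-M), w x ≠ 0)
    (hu : ∫ x in Set.Ici M, w x ≠ 0) :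
    BinEquiv M (fun x => binRatio M w h x * w x) h := by
  have el : ∀ x ∈ Set.Iic (-M), binRatio M w h x * w x
      = (∫ y in Set.Iic (-M), h y) / (∫ y in Set.Iic (-M), w y) * w x := fun x hx => by
    rw [binRatio_lower _ _ hx]
  have eu : ∀ x ∈ Set.Ici M, binRatio M w h x * w x
      = (∫ y in Set.Ici M, h y) / (∫ y in Set.Ici M, w y) * w x := fun x hx => by
    rw [binRatio_upper hM _ _ hx]
  have em : ∀ x ∈ Set.Ioo (-M) M, binRatio M w h x * w x = h x := fun x hx => by
    rw [binRatio_middle _ _ hx, div_mul_cancel₀ _ (hwpos x hx)]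
  refine ⟨?_, hh, ?_, ?_, ae_of_all _ em⟩
  · rw [integrable_iff_bins hM]
    exact ⟨IntegrableOn.congr_fun (Integrable.const_mul hw.integrableOn _)
        (fun x hx => (el x hx).symm) measurableSet_Iic,
      hh.integrableOn.congr_fun (fun x hx => (em x hx).symm) measurableSet_Ioo,
      IntegrableOn.congr_fun (Integrable.const_mul hw.integrableOn _)
        (fun x hx => (eu x hx).symm) measurableSet_Ici⟩
  · rw [setIntegral_congr_fun measurableSet_Iic el, integral_const_mul, div_mul_cancel₀ _ hl]
  · rw [setIntegral_congr_fun measurableSet_Ici eu, integral_const_mul, div_mul_cancel₀ _ hu]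

/-- A pilot density close to a positive density `g` can be replaced by a measurable weight that is
comparable to `g` everywhere. -/
lemma exists_binEquiv_weight (hM : 0 < M) {g f : ℝ → ℝ} (hg : Integrable g) (hgm : Measurable g)
    (hgpos : ∀ x, 0 < g x) (hf : Integrable f) {c : ℝ≥0} {η : ℝ} (hη : 0 < η)
    (hlow : ∀ x ∈ Set.Icc (-M) M, η ≤ g x) (hl : η ≤ ∫ x in Set.Iic (-M), g x)
    (hu : η ≤ ∫ x in Set.Ici M, g x) (hband : bandNorm M (fun x => g x - f x) ≤ c)
    (hc : c ≤ η / 2) :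
    ∃ w : ℝ → ℝ, Measurable w ∧ (∀ x, g x / 2 ≤ w x ∧ w x ≤ 2 * g x) ∧ BinEquiv M w f := by
  obtain ⟨f', hf'm, hff'⟩ := hf.aestronglyMeasurable.aemeasurable
  have hf' : Integrable f' := hf.congr hff'
  have hk : ∀ᵐ x, binRatio M g f' x = 1 - binRatio M g (fun x => g x - f x) x := by
    filter_upwards [hff'] with x hx
    by_cases h1 : x ≤ -M
    · rw [binRatio_lower _ _ h1, binRatio_lower _ _ h1,
        integral_sub hg.integrableOn hf.integrableOn,
        integral_congr_ae (ae_restrict_of_ae hff'), sub_div, div_self (by linarith)]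
      ring
    by_cases h2 : M ≤ x
    · rw [binRatio_upper hM _ _ h2, binRatio_upper hM _ _ h2,
        integral_sub hg.integrableOn hf.integrableOn,
        integral_congr_ae (ae_restrict_of_ae hff'), sub_div, div_self (by linarith)]
      ring
    rw [not_le] at h1 h2
    rw [binRatio_middle _ _ ⟨h1, h2⟩, binRatio_middle _ _ ⟨h1, h2⟩, sub_div,
      div_self (hgpos x).ne', hx]
    ring
  -- The ratio differs from `1` by at most `c/η ≤ 1/2` almost everywhere, so the truncation to
  -- `[1/2, 2]` changes it only on a null set; it makes the bounds hold at every point.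
  set k : ℝ → ℝ := fun x => max (1 / 2) (min 2 (binRatio M g f' x)) with hkdef
  have hkm : Measurable k := measurable_const.max (measurable_const.min
    (measurable_binRatio hgm hf'm))
  have hkeq : ∀ᵐ x, k x = binRatio M g f' x := by
    filter_upwards [hk] with x hx
    have h1 := abs_binRatio_le hM hη hband hlow hl hu x
    have h2 : (c : ℝ) / η ≤ 1 / 2 := by
      rw [div_le_iff₀ hη]; linarith
    have h3 := abs_le.1 (h1.trans h2)
    rw [hkdef]
    simp only
    rw [hx, min_eq_right (by linarith), max_eq_right (by linarith)]
  have hB : BinEquiv M (fun x => binRatio M g f' x * g x) f' :=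
    binEquiv_binRatio_mul hM hg hf' (fun x _ => (hgpos x).ne') (by linarith) (by linarith)
  have hw : (fun x => k x * g x) =ᵐ[volume] fun x => binRatio M g f' x * g x := by
    filter_upwards [hkeq] with x hx
    rw [hx]
  refine ⟨fun x => k x * g x, hkm.mul hgm, fun x => ?_, ?_⟩
  · have h1 : 1 / 2 ≤ k x := le_max_left _ _
    have h2 : k x ≤ 2 := max_le (by norm_num) (min_le_left _ _)
    constructor <;> nlinarith [hgpos x]
  · refine ⟨hB.1.congr hw.symm, hf, ?_, ?_, ?_⟩
    · rw [integral_congr_ae (ae_restrict_of_ae hw), hB.lower,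
        integral_congr_ae (ae_restrict_of_ae hff')]
    · rw [integral_congr_ae (ae_restrict_of_ae hw), hB.upper,
        integral_congr_ae (ae_restrict_of_ae hff')]
    · filter_upwards [hw, hff', hB.middle] with x h1 h2 h3 hx
      rw [h1, h3 hx, h2]

end Bins

/-! ### Convexity and diameter of the localized class -/

section Localization

variable {𝒢 : Set (Measure ℝ)} {M : ℝ} {f : ℝ → ℝ} {c : ℝ≥0}

lemma bandNorm_sub_le_of_mem (h𝒢 : ∀ H ∈ 𝒢, IsProbabilityMeasure H) (hf : Integrable f)
    {H₁ H₂ : Measure ℝ} (h₁ : H₁ ∈ localization 𝒢 M f c) (h₂ : H₂ ∈ localization 𝒢 M f c) :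
    bandNorm M (fun x => marginalDensity H₁ x - marginalDensity H₂ x) ≤ ((2 * c : ℝ≥0) : ℝ≥0∞) := by
  obtain ⟨g₁, b₁⟩ := h₁
  obtain ⟨g₂, b₂⟩ := h₂
  have := h𝒢 _ g₁
  have := h𝒢 _ g₂
  rw [bandNorm_le_iff] at b₁ b₂ ⊢
  have tri : ∀ a b : ℝ, |a| ≤ c → |b| ≤ c → |a - b| ≤ (2 * c : ℝ≥0) := fun a b ha hb => by
    push_cast
    exact (abs_sub _ _).trans (by linarith)
  have set_eq : ∀ s : Set ℝ, ∫ x in s, (marginalDensity H₁ x - marginalDensity H₂ x)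
      = (∫ x in s, (marginalDensity H₁ x - f x)) - ∫ x in s, (marginalDensity H₂ x - f x) := by
    intro s
    have i₁ : IntegrableOn (fun x => marginalDensity H₁ x - f x) s :=
      ((integrable_marginalDensity H₁).sub hf).integrableOn
    have i₂ : IntegrableOn (fun x => marginalDensity H₂ x - f x) s :=
      ((integrable_marginalDensity H₂).sub hf).integrableOn
    rw [← integral_sub i₁ i₂]
    congr 1; ext x; ring
  refine ⟨fun x hx => ?_, ?_, ?_⟩
  · have := tri _ _ (b₁.1 x hx) (b₂.1 x hx)
    rwa [sub_sub_sub_cancel_right] at this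
  · rw [set_eq]; exact tri _ _ b₁.2.1 b₂.2.1
  · rw [set_eq]; exact tri _ _ b₁.2.2 b₂.2.2

lemma convex_localization (h𝒢 : ∀ H ∈ 𝒢, IsProbabilityMeasure H) (hconv : Convex ℝ≥0 𝒢)
    (hf : Integrable f) : Convex ℝ≥0 (localization 𝒢 M f c) := by
  rintro H₁ ⟨g₁, b₁⟩ H₂ ⟨g₂, b₂⟩ a b ha hb hab
  have := h𝒢 _ g₁
  have := h𝒢 _ g₂
  refine ⟨hconv g₁ g₂ ha hb hab, ?_⟩
  have hab' : (a : ℝ) + b = 1 := by exact_mod_cast hab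
  have hpt : ∀ x, marginalDensity (a • H₁ + b • H₂) x - f x
      = a * (marginalDensity H₁ x - f x) + b * (marginalDensity H₂ x - f x) := fun x => by
    rw [marginalDensity_combination]
    linear_combination f x * hab'
  simp only [hpt]
  rw [bandNorm_le_iff] at b₁ b₂ ⊢
  have comb : ∀ u v : ℝ, |u| ≤ c → |v| ≤ c → |a * u + b * v| ≤ c := fun u v hu hv => by
    refine (abs_add_le _ _).trans ?_
    rw [abs_mul, abs_mul, abs_of_nonneg a.coe_nonneg, abs_of_nonneg b.coe_nonneg]
    calc (a : ℝ) * |u| + b * |v| ≤ a * c + b * c := by gcongr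
      _ = c := by rw [← add_mul, hab', one_mul]
  have set_eq : ∀ s : Set ℝ, ∫ x in s, (a * (marginalDensity H₁ x - f x)
        + b * (marginalDensity H₂ x - f x))
      = a * (∫ x in s, (marginalDensity H₁ x - f x))
        + b * ∫ x in s, (marginalDensity H₂ x - f x) := by
    intro s
    rw [← integral_const_mul, ← integral_const_mul, ← integral_add]
    · exact (((integrable_marginalDensity H₁).sub hf).integrableOn).const_mul _
    · exact (((integrable_marginalDensity H₂).sub hf).integrableOn).const_mul _
  refine ⟨fun x hx => comb _ _ (b₁.1 x hx) (b₂.1 x hx), ?_, ?_⟩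
  · rw [set_eq]; exact comb _ _ b₁.2.1 b₂.2.1
  · rw [set_eq]; exact comb _ _ b₁.2.2 b₂.2.2

end Localization

/-! ### Differences of marginal densities -/

section DensityDifference

/-- The difference of two marginal densities. -/
noncomputable def densityDiff (H₁ H₂ : Measure ℝ) (x : ℝ) : ℝ :=
  marginalDensity H₁ x - marginalDensity H₂ x

variable (H₁ H₂ : Measure ℝ) [IsProbabilityMeasure H₁] [IsProbabilityMeasure H₂]

lemma integrable_densityDiff : Integrable (densityDiff H₁ H₂) :=
  (integrable_marginalDensity H₁).sub (integrable_marginalDensity H₂)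

lemma measurable_densityDiff : Measurable (densityDiff H₁ H₂) :=
  (continuous_marginalDensity H₁).measurable.sub (continuous_marginalDensity H₂).measurable

lemma integral_densityDiff : ∫ x, densityDiff H₁ H₂ x = 0 := by
  unfold densityDiff
  rw [integral_sub (integrable_marginalDensity H₁) (integrable_marginalDensity H₂),
    integral_marginalDensity, integral_marginalDensity, sub_self]

lemma integral_marginal (u : ℝ → ℝ) : ∫ x, u x ∂(marginal H₁) = ∫ x, u x * marginalDensity H₁ x :=
  integral_withDensity_ofReal (continuous_marginalDensity H₁).measurable
    (marginalDensity_nonneg H₁) u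

lemma integrable_marginal (u : ℝ → ℝ) :
    Integrable u (marginal H₁) ↔ Integrable fun x => u x * marginalDensity H₁ x :=
  integrable_withDensity_ofReal (continuous_marginalDensity H₁).measurable
    (marginalDensity_nonneg H₁) u

lemma integrable_mul_densityDiff {Q : ℝ → ℝ} (h₁ : Integrable Q (marginal H₁))
    (h₂ : Integrable Q (marginal H₂)) : Integrable fun x => Q x * densityDiff H₁ H₂ x := by
  rw [integrable_marginal] at h₁ h₂
  refine (h₁.sub h₂).congr (ae_of_all _ fun x => ?_)
  simp only [densityDiff, Pi.sub_apply]; ring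

lemma integral_mul_densityDiff {Q : ℝ → ℝ} (h₁ : Integrable Q (marginal H₁))
    (h₂ : Integrable Q (marginal H₂)) :
    ∫ x, Q x * densityDiff H₁ H₂ x = ∫ x, Q x ∂(marginal H₁) - ∫ x, Q x ∂(marginal H₂) := by
  rw [integral_marginal, integral_marginal]
  rw [integrable_marginal] at h₁ h₂
  rw [← integral_sub h₁ h₂]
  refine integral_congr_ae (ae_of_all _ fun x => ?_)
  simp only [densityDiff]; ring

end DensityDifference

/-! ### The weighted distance as a norm in `L²(w)` -/

section WeightedSpace

/-- The measure with Lebesgue density `w`. -/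
noncomputable def weightMeasure (w : ℝ → ℝ) : Measure ℝ :=
  volume.withDensity fun x => ENNReal.ofReal (w x)

variable {M : ℝ} {w f : ℝ → ℝ}

lemma isFiniteMeasure_weightMeasure (hw : Integrable w) : IsFiniteMeasure (weightMeasure w) :=
  isFiniteMeasure_withDensity_ofReal hw.2

lemma ae_weightMeasure_iff (hwm : Measurable w) (hpos : ∀ x, 0 < w x) {p : ℝ → Prop} :
    (∀ᵐ x ∂(weightMeasure w), p x) ↔ ∀ᵐ x, p x := by
  rw [weightMeasure, ae_withDensity_iff hwm.ennreal_ofReal]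
  simp [hpos]

lemma setIntegral_pos_of_pos (hw : Integrable w) (hpos : ∀ x, 0 < w x) {s : Set ℝ}
    (hs : volume s ≠ 0) : 0 < ∫ x in s, w x := by
  rw [integral_pos_iff_support_of_nonneg (fun x => (hpos x).le) hw.integrableOn]
  have : Function.support w = Set.univ := Set.eq_univ_of_forall fun u => (hpos u).ne'
  rw [this, Measure.restrict_apply_univ]
  exact pos_iff_ne_zero.2 hs

lemma binEquiv_binRatio_mul_of_pos (hM : 0 < M) {h : ℝ → ℝ} (hw : Integrable w)
    (hpos : ∀ x, 0 < w x) (hh : Integrable h) :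
    BinEquiv M (fun x => binRatio M w h x * w x) h :=
  binEquiv_binRatio_mul hM hw hh (fun x _ => (hpos x).ne')
    (setIntegral_pos_of_pos hw hpos (by simp)).ne' (setIntegral_pos_of_pos hw hpos (by simp)).ne'

/-- Integration of tail constant weights against `h` is a pairing with the density of `h`. -/
lemma integral_mul_binRatio (hM : 0 < M) {h Q : ℝ → ℝ} (hwm : Measurable w) (hw : Integrable w)
    (hpos : ∀ x, 0 < w x) (hh : Integrable h) (hQ : TailConst M Q)
    (hi : Integrable fun x => Q x * h x) :
    ∫ x, Q x * binRatio M w h x ∂(weightMeasure w) = ∫ x, Q x * h x := by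
  rw [weightMeasure, integral_withDensity_ofReal hwm fun x => (hpos x).le,
    (binEquiv_binRatio_mul_of_pos hM hw hpos hh).symm.integral_mul_eq hM hQ hi]
  simp only [mul_assoc]

lemma integrable_bounded_mul {h Q : ℝ → ℝ} (hh : Integrable h) (hQ : Measurable Q) {C : ℝ}
    (hC : ∀ x, |Q x| ≤ C) : Integrable fun x => Q x * h x :=
  hh.bdd_mul hQ.aestronglyMeasurable (ae_of_all _ fun x => by rw [Real.norm_eq_abs]; exact hC x)

/-- The ratio `r` is tail constant, so `∫ r² w = ∫ r D` with `D` the density difference; splitting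
the latter over the three bins gives the three terms of the distance. -/
lemma weightedSqDist_eq_integral (hM : 0 < M) (hwm : Measurable w) (hpos : ∀ x, 0 < w x)
    (hwf : BinEquiv M w f) {H₁ H₂ : Measure ℝ} [IsProbabilityMeasure H₁]
    [IsProbabilityMeasure H₂] {C : ℝ} (hC : ∀ x, |binRatio M w (densityDiff H₁ H₂) x| ≤ C) :
    IntegrableOn (fun x => (marginalDensity H₁ x - marginalDensity H₂ x) ^ 2 / f x)
      (Set.Icc (-M) M) ∧
    weightedSqDist M f H₁ H₂
      = ∫ x, binRatio M w (densityDiff H₁ H₂) x ^ 2 ∂(weightMeasure w) := by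
  set D := densityDiff H₁ H₂ with hD
  set r := binRatio M w D with hr
  have hw := hwf.left_integrable
  have hDi : Integrable D := integrable_densityDiff H₁ H₂
  have hrm : Measurable r := measurable_binRatio hwm (measurable_densityDiff H₁ H₂)
  have hrD : Integrable fun x => r x * D x := integrable_bounded_mul hDi hrm hC
  have hmid : ∀ᵐ x, x ∈ Set.Ioo (-M) M →
      r x * D x = (marginalDensity H₁ x - marginalDensity H₂ x) ^ 2 / f x := by
    filter_upwards [hwf.middle] with x hx hxm
    rw [hr, binRatio_middle _ _ hxm, hx hxm, hD]
    simp only [densityDiff]; ring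
  have hmid' : (fun x => r x * D x) =ᵐ[volume.restrict (Set.Ioo (-M) M)]
      fun x => (marginalDensity H₁ x - marginalDensity H₂ x) ^ 2 / f x := by
    filter_upwards [ae_restrict_mem measurableSet_Ioo, ae_restrict_of_ae hmid] with x hx hx'
    exact hx' hx
  constructor
  · rw [integrableOn_Icc_iff_integrableOn_Ioo]
    exact Integrable.congr hrD.integrableOn hmid'
  · have e1 : ∫ x, r x ^ 2 ∂(weightMeasure w) = ∫ x, r x * D x := by
      simp only [pow_two]
      exact integral_mul_binRatio hM hwm hw hpos hDi (tailConst_binRatio hM w D) hrD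
    rw [e1, integral_eq_bins hM hrD]
    have el : ∫ x in Set.Iic (-M), r x * D x
        = (∫ x in Set.Iic (-M), D x) ^ 2 / ∫ x in Set.Iic (-M), f x := by
      rw [setIntegral_congr_fun measurableSet_Iic (g := fun x =>
        ((∫ y in Set.Iic (-M), D y) / ∫ y in Set.Iic (-M), w y) * D x)
        (fun x hx => by simp only [hr, binRatio_lower _ _ hx]), integral_const_mul, hwf.lower]
      ring
    have eu : ∫ x in Set.Ici M, r x * D x
        = (∫ x in Set.Ici M, D x) ^ 2 / ∫ x in Set.Ici M, f x := by
      rw [setIntegral_congr_fun measurableSet_Ici (g := fun x =>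
        ((∫ y in Set.Ici M, D y) / ∫ y in Set.Ici M, w y) * D x)
        (fun x hx => by simp only [hr, binRatio_upper hM _ _ hx]), integral_const_mul, hwf.upper]
      ring
    rw [el, eu, integral_congr_ae hmid', ← integral_Icc_eq_integral_Ioo]
    rfl

end WeightedSpace

/-! ### The convex set behind the modulus problem -/

section ModulusSet

variable {M : ℝ} {w f : ℝ → ℝ}

/-- The pairs of the modulus problem, embedded into `L²(w) × ℝ`. -/
noncomputable def modulusSet (ψ : ℝ → ℝ) (𝒢m : Set (Measure ℝ)) (M : ℝ) (w : ℝ → ℝ) :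
    Set (Lp ℝ 2 (weightMeasure w) × ℝ) :=
  {p | ∃ H₁ ∈ 𝒢m, ∃ H₂ ∈ 𝒢m,
    (p.1 : ℝ → ℝ) =ᵐ[weightMeasure w] binRatio M w (densityDiff H₁ H₂) ∧
    p.2 = linFun ψ H₁ - linFun ψ H₂}

lemma inner_Lp_eq_integral {ν : Measure ℝ} {u v : Lp ℝ 2 ν} {a b : ℝ → ℝ} (hu : u =ᵐ[ν] a)
    (hv : v =ᵐ[ν] b) : inner ℝ u v = ∫ x, a x * b x ∂ν := by
  rw [L2.inner_def]
  refine integral_congr_ae ?_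
  filter_upwards [hu, hv] with x h1 h2
  rw [h1, h2]
  simp [mul_comm]

lemma norm_sq_Lp_eq_integral {ν : Measure ℝ} {u : Lp ℝ 2 ν} {a : ℝ → ℝ} (hu : u =ᵐ[ν] a) :
    ‖u‖ ^ 2 = ∫ x, a x ^ 2 ∂ν := by
  rw [← real_inner_self_eq_norm_sq, inner_Lp_eq_integral hu hu]
  simp only [pow_two]

lemma binRatio_combination (hM : 0 < M) {h h' : ℝ → ℝ} (hh : Integrable h) (hh' : Integrable h')
    (a b : ℝ) (x : ℝ) :
    binRatio M w (fun x => a * h x + b * h' x) x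
      = a * binRatio M w h x + b * binRatio M w h' x := by
  have set_eq : ∀ s : Set ℝ, ∫ x in s, (a * h x + b * h' x)
      = a * (∫ x in s, h x) + b * ∫ x in s, h' x := by
    intro s
    rw [← integral_const_mul, ← integral_const_mul, ← integral_add]
    · exact hh.integrableOn.const_mul _
    · exact hh'.integrableOn.const_mul _
  by_cases h1 : x ≤ -M
  · rw [binRatio_lower _ _ h1, binRatio_lower _ _ h1, binRatio_lower _ _ h1, set_eq]; ring
  by_cases h2 : M ≤ x
  · rw [binRatio_upper hM _ _ h2, binRatio_upper hM _ _ h2, binRatio_upper hM _ _ h2, set_eq]; ring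
  rw [not_le] at h1 h2
  rw [binRatio_middle _ _ ⟨h1, h2⟩, binRatio_middle _ _ ⟨h1, h2⟩, binRatio_middle _ _ ⟨h1, h2⟩]
  ring

lemma convex_modulusSet (hM : 0 < M) {ψ : ℝ → ℝ} {𝒢m : Set (Measure ℝ)}
    (hprob : ∀ H ∈ 𝒢m, IsProbabilityMeasure H) (hψ : ∀ H ∈ 𝒢m, Integrable ψ H)
    (hconv : Convex ℝ≥0 𝒢m) : Convex ℝ (modulusSet ψ 𝒢m M w) := by
  rintro ⟨v, ℓ⟩ ⟨H₁, h₁, H₂, h₂, hv, hℓ⟩ ⟨v', ℓ'⟩ ⟨K₁, k₁, K₂, k₂, hv', hℓ'⟩ a b ha hb hab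
  lift a to ℝ≥0 using ha
  lift b to ℝ≥0 using hb
  have hab' : a + b = 1 := by exact_mod_cast hab
  have := hprob _ h₁
  have := hprob _ h₂
  have := hprob _ k₁
  have := hprob _ k₂
  refine ⟨a • H₁ + b • K₁, hconv h₁ k₁ zero_le zero_le hab',
    a • H₂ + b • K₂, hconv h₂ k₂ zero_le zero_le hab', ?_, ?_⟩
  · have hd : densityDiff (a • H₁ + b • K₁) (a • H₂ + b • K₂)
        = fun x => a * densityDiff H₁ H₂ x + b * densityDiff K₁ K₂ x := by
      ext x
      simp only [densityDiff, marginalDensity_combination]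
      ring
    rw [hd]
    filter_upwards [hv, hv', Lp.coeFn_add ((a : ℝ) • v) ((b : ℝ) • v'),
      Lp.coeFn_smul (a : ℝ) v, Lp.coeFn_smul (b : ℝ) v'] with x e1 e2 e3 e4 e5
    rw [binRatio_combination hM (integrable_densityDiff H₁ H₂) (integrable_densityDiff K₁ K₂)]
    simp only [Prod.smul_mk, Prod.mk_add_mk]
    rw [e3, Pi.add_apply, e4, e5, Pi.smul_apply, Pi.smul_apply, e1, e2, smul_eq_mul, smul_eq_mul]
  · dsimp only at hℓ hℓ'
    simp only [Prod.smul_mk, Prod.mk_add_mk, smul_eq_mul]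
    rw [linFun_combination (hψ _ h₁) (hψ _ k₁), linFun_combination (hψ _ h₂) (hψ _ k₂), hℓ, hℓ']
    ring

end ModulusSet

/-- A localized convex class together with a weight `w` that represents the pilot density `f` and
is bounded below relative to the class. -/
structure RegularClass (ψ : ℝ → ℝ) (𝒢m : Set (Measure ℝ)) (M : ℝ) (f w : ℝ → ℝ) (C : ℝ) :
    Prop where
  cutoff_pos : 0 < M
  prob : ∀ H ∈ 𝒢m, IsProbabilityMeasure H
  integrable : ∀ H ∈ 𝒢m, Integrable ψ H
  convex : Convex ℝ≥0 𝒢m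
  bdd : ∃ B, ∀ H ∈ 𝒢m, |linFun ψ H| ≤ B
  nonempty : 𝒢m.Nonempty
  measurable_weight : Measurable w
  weight_pos : ∀ x, 0 < w x
  equiv : BinEquiv M w f
  bound : ∀ H₁ ∈ 𝒢m, ∀ H₂ ∈ 𝒢m, ∀ x, |binRatio M w (densityDiff H₁ H₂) x| ≤ C

/-! ### Minimax weights for a regular class -/

namespace RegularClass

variable {ψ : ℝ → ℝ} {𝒢m : Set (Measure ℝ)} {M : ℝ} {f w : ℝ → ℝ} {C : ℝ}

lemma measurable_binRatio_densityDiff (h : RegularClass ψ 𝒢m M f w C) {H₁ H₂ : Measure ℝ}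
    (h₁ : H₁ ∈ 𝒢m) (h₂ : H₂ ∈ 𝒢m) : Measurable (binRatio M w (densityDiff H₁ H₂)) := by
  have := h.prob _ h₁
  have := h.prob _ h₂
  exact measurable_binRatio h.measurable_weight (measurable_densityDiff H₁ H₂)

lemma memLp_binRatio (h : RegularClass ψ 𝒢m M f w C) {H₁ H₂ : Measure ℝ}
    (h₁ : H₁ ∈ 𝒢m) (h₂ : H₂ ∈ 𝒢m) :
    MemLp (binRatio M w (densityDiff H₁ H₂)) 2 (weightMeasure w) := by
  have := isFiniteMeasure_weightMeasure h.equiv.left_integrable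
  exact MemLp.of_bound (h.measurable_binRatio_densityDiff h₁ h₂).aestronglyMeasurable C
    (ae_of_all _ fun x => by rw [Real.norm_eq_abs]; exact h.bound _ h₁ _ h₂ x)

lemma toLp_mem_modulusSet (h : RegularClass ψ 𝒢m M f w C) {H₁ H₂ : Measure ℝ}
    (h₁ : H₁ ∈ 𝒢m) (h₂ : H₂ ∈ 𝒢m) :
    ((h.memLp_binRatio h₁ h₂).toLp _, linFun ψ H₁ - linFun ψ H₂) ∈ modulusSet ψ 𝒢m M w :=
  ⟨H₁, h₁, H₂, h₂, MemLp.coeFn_toLp (h.memLp_binRatio h₁ h₂), rfl⟩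

lemma norm_sq_eq_weightedSqDist (h : RegularClass ψ 𝒢m M f w C) {H₁ H₂ : Measure ℝ}
    (h₁ : H₁ ∈ 𝒢m) (h₂ : H₂ ∈ 𝒢m) {v : Lp ℝ 2 (weightMeasure w)}
    (hv : v =ᵐ[weightMeasure w] binRatio M w (densityDiff H₁ H₂)) :
    ‖v‖ ^ 2 = weightedSqDist M f H₁ H₂ := by
  have := h.prob _ h₁
  have := h.prob _ h₂
  rw [norm_sq_Lp_eq_integral hv, (weightedSqDist_eq_integral h.cutoff_pos h.measurable_weight
    h.weight_pos h.equiv (h.bound _ h₁ _ h₂)).2]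

lemma norm_le_iff (h : RegularClass ψ 𝒢m M f w C) {H₁ H₂ : Measure ℝ}
    (h₁ : H₁ ∈ 𝒢m) (h₂ : H₂ ∈ 𝒢m) {v : Lp ℝ 2 (weightMeasure w)}
    (hv : v =ᵐ[weightMeasure w] binRatio M w (densityDiff H₁ H₂)) {δ : ℝ} (hδ : 0 < δ) :
    ‖v‖ ≤ δ ↔ ModulusFeasible 𝒢m M f δ H₁ H₂ := by
  have := h.prob _ h₁
  have := h.prob _ h₂
  have hint := (weightedSqDist_eq_integral h.cutoff_pos h.measurable_weight
    h.weight_pos h.equiv (h.bound _ h₁ _ h₂)).1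
  rw [← sq_le_sq₀ (norm_nonneg _) hδ.le, h.norm_sq_eq_weightedSqDist h₁ h₂ hv]
  exact ⟨fun hle => ⟨h₁, h₂, hint, hle⟩, fun hf => hf.2.2.2⟩

/-- Transfers the modulus to the Hilbert space, where concavity and first-order optimality are
available. Positivity of `δ` is what allows the passage between `‖v‖ ≤ δ` and the squared
constraint. -/
lemma modulus_eq (h : RegularClass ψ 𝒢m M f w C) {δ : ℝ} (hδ : 0 < δ) :
    modulus ψ 𝒢m M f δ = abstractModulus (modulusSet ψ 𝒢m M w) δ := by
  unfold modulus abstractModulus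
  congr 1
  ext d
  constructor
  · rintro ⟨H₁, H₂, hf, rfl⟩
    exact ⟨_, h.toLp_mem_modulusSet hf.1 hf.2.1,
      (h.norm_le_iff hf.1 hf.2.1 (MemLp.coeFn_toLp _) hδ).2 hf⟩
  · rintro ⟨v, ⟨H₁, h₁, H₂, h₂, hv, hd⟩, hn⟩
    exact ⟨H₁, H₂, (h.norm_le_iff h₁ h₂ hv hδ).1 hn, hd⟩

lemma superdifferential_eq (h : RegularClass ψ 𝒢m M f w C) {δ : ℝ} (hδ : 0 < δ) :
    superdifferential (modulus ψ 𝒢m M f) δ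
      = superdifferential (abstractModulus (modulusSet ψ 𝒢m M w)) δ := by
  ext s
  constructor
  · intro hs δ' hδ'
    rw [← h.modulus_eq hδ', ← h.modulus_eq hδ]; exact hs δ' hδ'
  · intro hs δ' hδ'
    rw [h.modulus_eq hδ', h.modulus_eq hδ]; exact hs δ' hδ'

lemma bddAbove_modulusSet (h : RegularClass ψ 𝒢m M f w C) :
    BddAbove (Prod.snd '' modulusSet ψ 𝒢m M w) := by
  obtain ⟨B, hB⟩ := h.bdd
  refine ⟨2 * B, ?_⟩
  rintro _ ⟨⟨v, ℓ⟩, ⟨H₁, h₁, H₂, h₂, -, hℓ⟩, rfl⟩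
  have e1 := (abs_le.1 (hB _ h₁)).2
  have e2 := (abs_le.1 (hB _ h₂)).1
  simp only at hℓ ⊢
  linarith

lemma zero_mem_modulusSet (h : RegularClass ψ 𝒢m M f w C) :
    ((0 : Lp ℝ 2 (weightMeasure w)), (0 : ℝ)) ∈ modulusSet ψ 𝒢m M w := by
  obtain ⟨H, hH⟩ := h.nonempty
  refine ⟨H, hH, H, hH, ?_, by simp⟩
  have : binRatio M w (densityDiff H H) = 0 := by
    have hd : densityDiff H H = fun _ => 0 := by ext x; simp [densityDiff]
    ext x
    simp [binRatio, hd]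
  rw [this]
  exact Lp.coeFn_zero _ _ _

lemma convex_modulusSet (h : RegularClass ψ 𝒢m M f w C) : Convex ℝ (modulusSet ψ 𝒢m M w) :=
  BiasAware.convex_modulusSet h.cutoff_pos h.prob h.integrable h.convex

lemma superdifferential_modulus_nonempty (h : RegularClass ψ 𝒢m M f w C) {δ : ℝ} (hδ : 0 < δ) :
    (superdifferential (modulus ψ 𝒢m M f) δ).Nonempty := by
  rw [h.superdifferential_eq hδ]
  exact superdifferential_nonempty (abstractModulus_concaveOn h.convex_modulusSet
    h.bddAbove_modulusSet h.zero_mem_modulusSet) hδ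

section Pairing

variable {m : ℕ} {Γ : ℝ} {Q : ℝ → ℝ}

lemma tailConst_of_weightFeasible (hQ : WeightFeasible m 𝒢m M f Γ Q) : TailConst M Q :=
  ⟨hQ.2.1, hQ.2.2.1⟩

lemma integral_sq_weightMeasure (h : RegularClass ψ 𝒢m M f w C) (hQ : TailConst M Q)
    (hi : Integrable fun x => Q x ^ 2 * f x) :
    Integrable (fun x => Q x ^ 2) (weightMeasure w) ∧
      ∫ x, Q x ^ 2 ∂(weightMeasure w) = ∫ x, Q x ^ 2 * f x := by
  have hQ2 : TailConst M fun x => Q x ^ 2 := hQ.comp₂ hQ fun a _ => a ^ 2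
  have hi' : Integrable fun x => Q x ^ 2 * w x :=
    h.equiv.symm.integrable_mul h.cutoff_pos hQ2 hi
  refine ⟨(integrable_withDensity_ofReal h.measurable_weight (fun x => (h.weight_pos x).le) _).2
    hi', ?_⟩
  rw [weightMeasure, integral_withDensity_ofReal h.measurable_weight
    (fun x => (h.weight_pos x).le)]
  exact h.equiv.integral_mul_eq h.cutoff_pos hQ2 hi'

lemma memLp_weights (h : RegularClass ψ 𝒢m M f w C) (hQ : WeightFeasible m 𝒢m M f Γ Q) :
    MemLp Q 2 (weightMeasure w) :=
  (memLp_two_iff_integrable_sq hQ.1.aestronglyMeasurable).2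
    (h.integral_sq_weightMeasure (tailConst_of_weightFeasible hQ) hQ.2.2.2.2.1).1

lemma norm_weights_le (h : RegularClass ψ 𝒢m M f w C) {s : ℝ} (hs : 0 ≤ s) (hm : 0 < m)
    (hQ : WeightFeasible m 𝒢m M f (s ^ 2 / m) Q) : ‖(h.memLp_weights hQ).toLp Q‖ ≤ s := by
  have hm' : (0 : ℝ) < m := by exact_mod_cast hm
  rw [← sq_le_sq₀ (norm_nonneg _) hs, norm_sq_Lp_eq_integral (MemLp.coeFn_toLp _),
    (h.integral_sq_weightMeasure (tailConst_of_weightFeasible hQ) hQ.2.2.2.2.1).2]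
  have := hQ.2.2.2.2.2
  rw [one_div, inv_mul_eq_div, div_le_div_iff_of_pos_right hm'] at this
  exact this

/-- Links the inner product of `L²(w)` to bias: pairing the weights with a point of the modulus set
gives the change in the estimator's mean between two distributions. -/
lemma integral_mul_binRatio_eq_sub (h : RegularClass ψ 𝒢m M f w C) {H₁ H₂ : Measure ℝ}
    (h₁ : H₁ ∈ 𝒢m) (h₂ : H₂ ∈ 𝒢m) (hQ : TailConst M Q) (i₁ : Integrable Q (marginal H₁))
    (i₂ : Integrable Q (marginal H₂)) :
    ∫ x, Q x * binRatio M w (densityDiff H₁ H₂) x ∂(weightMeasure w)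
      = ∫ x, Q x ∂(marginal H₁) - ∫ x, Q x ∂(marginal H₂) := by
  have := h.prob _ h₁
  have := h.prob _ h₂
  rw [integral_mul_binRatio h.cutoff_pos h.measurable_weight h.equiv.left_integrable h.weight_pos
    (integrable_densityDiff H₁ H₂) hQ (integrable_mul_densityDiff H₁ H₂ i₁ i₂),
    integral_mul_densityDiff H₁ H₂ i₁ i₂]

end Pairing

lemma abs_le_of_worstSqBias_le {Q₀ : ℝ} {Q : ℝ → ℝ} {B : ℝ} (hB : 0 ≤ B)
    (hle : worstSqBias ψ 𝒢m Q₀ Q ≤ ENNReal.ofReal (B ^ 2)) {H : Measure ℝ} (hH : H ∈ 𝒢m) :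
    |Q₀ + (∫ x, Q x ∂(marginal H)) - linFun ψ H| ≤ B := by
  have h1 : ENNReal.ofReal ((Q₀ + (∫ x, Q x ∂(marginal H)) - linFun ψ H) ^ 2)
      ≤ ENNReal.ofReal (B ^ 2) :=
    (le_iSup₂ (f := fun H (_ : H ∈ 𝒢m) =>
      ENNReal.ofReal ((Q₀ + (∫ x, Q x ∂(marginal H)) - linFun ψ H) ^ 2)) H hH).trans hle
  rw [ENNReal.ofReal_le_ofReal_iff (sq_nonneg B)] at h1
  exact abs_le_of_sq_le_sq h1 hB

/-- Existence of a minimax solution, and the form that any solution takes. -/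
lemma minimax_of_attained (h : RegularClass ψ 𝒢m M f w C) {δ s : ℝ} (hδ : 0 < δ)
    (hs : s ∈ superdifferential (modulus ψ 𝒢m M f) δ) {m : ℕ} (hm : 0 < m)
    (hatt : ModulusAttained ψ 𝒢m M f δ) :
    0 ≤ s ∧ ∃ H₁ ∈ 𝒢m, ∃ H₂ ∈ 𝒢m, (∃ q₀ q, IsMinimax m ψ 𝒢m M f (s ^ 2 / m) q₀ q) ∧
      ∀ q₀ q, IsMinimax m ψ 𝒢m M f (s ^ 2 / m) q₀ q →
        (∀ᵐ x, q x = s / δ * binRatio M w (densityDiff H₁ H₂) x) ∧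
        (0 < s → ∫ x, binRatio M w (densityDiff H₁ H₂) x ^ 2 ∂(weightMeasure w) = δ ^ 2) := by
  rw [h.superdifferential_eq hδ] at hs
  have hs0 : 0 ≤ s := nonneg_of_mem_superdifferential_abstractModulus h.bddAbove_modulusSet
    h.zero_mem_modulusSet hδ hs
  obtain ⟨H₁, H₂, hfeas, hval⟩ := hatt
  rw [h.modulus_eq hδ] at hval
  obtain ⟨h₁, h₂⟩ : H₁ ∈ 𝒢m ∧ H₂ ∈ 𝒢m := ⟨hfeas.1, hfeas.2.1⟩
  have hm' : (0 : ℝ) < m := by exact_mod_cast hm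
  set ω := abstractModulus (modulusSet ψ 𝒢m M w) δ with hω
  set r := binRatio M w (densityDiff H₁ H₂) with hr
  set v₀ := (h.memLp_binRatio h₁ h₂).toLp r with hv₀def
  have hv₀ae : v₀ =ᵐ[weightMeasure w] r := MemLp.coeFn_toLp _
  have hv₀ : ‖v₀‖ ≤ δ := (h.norm_le_iff h₁ h₂ hv₀ae hδ).2 hfeas
  have hv₀mem : (v₀, ω) ∈ modulusSet ψ 𝒢m M w := by
    have := h.toLp_mem_modulusSet h₁ h₂
    rwa [hval] at this
  have hopt : ∀ {v ℓ}, (v, ℓ) ∈ modulusSet ψ 𝒢m M w →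
      ℓ - s / δ * inner ℝ v₀ v ≤ ω - s * δ := fun hmem =>
    sub_inner_le_of_attained h.convex_modulusSet h.bddAbove_modulusSet hδ hs hv₀mem hv₀ hmem
  -- The minimax bias; it is nonnegative by optimality tested at the point `(0, 0)`.
  set B := (ω - s * δ) / 2 with hBdef
  have hB0 : 0 ≤ B := by
    have := hopt h.zero_mem_modulusSet
    rw [inner_zero_right] at this
    rw [hBdef]; linarith
  -- lower bound for the bias of feasible weights
  have hinner : ∀ {q} (hq : WeightFeasible m 𝒢m M f (s ^ 2 / m) q),
      inner ℝ ((h.memLp_weights hq).toLp q) v₀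
        = ∫ x, q x ∂(marginal H₁) - ∫ x, q x ∂(marginal H₂) := by
    intro q hq
    rw [inner_Lp_eq_integral (MemLp.coeFn_toLp (h.memLp_weights hq)) hv₀ae]
    exact h.integral_mul_binRatio_eq_sub h₁ h₂ (tailConst_of_weightFeasible hq)
      (hq.2.2.2.1 _ h₁) (hq.2.2.2.1 _ h₂)
  -- The biases at `H₂` and `H₁` differ by `ω - ⟨q, v₀⟩ ≥ ω - sδ = 2B`, so one of them is at least
  -- `B` in absolute value, whatever the intercept.
  have hlower : ∀ q₀ q, WeightFeasible m 𝒢m M f (s ^ 2 / m) q →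
      ENNReal.ofReal (B ^ 2) ≤ worstSqBias ψ 𝒢m q₀ q := by
    intro q₀ q hq
    by_contra! hlt
    obtain ⟨B', hB'⟩ : ∃ B' : ℝ, 0 ≤ B' ∧ B' < B ∧
        worstSqBias ψ 𝒢m q₀ q ≤ ENNReal.ofReal (B' ^ 2) := by
      have hne : worstSqBias ψ 𝒢m q₀ q ≠ ∞ := hlt.ne_top
      refine ⟨√(worstSqBias ψ 𝒢m q₀ q).toReal, Real.sqrt_nonneg _, ?_, ?_⟩
      · rw [Real.sqrt_lt' (lt_of_le_of_ne hB0 fun h0 => by simp [← h0] at hlt)]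
        exact (ENNReal.lt_ofReal_iff_toReal_lt hne).1 hlt
      · rw [Real.sq_sqrt ENNReal.toReal_nonneg, ENNReal.ofReal_toReal hne]
    have b₁ := abs_le_of_worstSqBias_le hB'.1 hB'.2.2 h₁
    have b₂ := abs_le_of_worstSqBias_le hB'.1 hB'.2.2 h₂
    rw [abs_le] at b₁ b₂
    have hcs : inner ℝ ((h.memLp_weights hq).toLp q) v₀ ≤ s * δ :=
      (real_inner_le_norm _ _).trans
        (mul_le_mul (h.norm_weights_le hs0 hm hq) hv₀ (norm_nonneg _) hs0)
    rw [hinner hq] at hcs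
    rw [hBdef] at hB'
    linarith [b₁.1, b₂.2, hB'.2.1]
  -- the candidate
  set q := fun x => s / δ * r x with hqdef
  have hrm : Measurable r := h.measurable_binRatio_densityDiff h₁ h₂
  have hqm : Measurable q := hrm.const_mul _
  have hqt : TailConst M q := (tailConst_binRatio h.cutoff_pos _ _).comp₂
    (tailConst_binRatio h.cutoff_pos w (densityDiff H₁ H₂)) fun a _ => s / δ * a
  have hqb : ∀ x, |q x| ≤ s / δ * C := fun x => by
    rw [hqdef]
    simp only
    rw [abs_mul, abs_of_nonneg (by positivity)]
    exact mul_le_mul_of_nonneg_left (h.bound _ h₁ _ h₂ x) (by positivity)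
  have hqi : ∀ H ∈ 𝒢m, Integrable q (marginal H) := fun H hH => by
    have := h.prob _ hH
    exact Integrable.of_bound hqm.aestronglyMeasurable (s / δ * C)
      (ae_of_all _ fun x => by rw [Real.norm_eq_abs]; exact hqb x)
  have hq2w : Integrable fun x => q x ^ 2 * w x := by
    refine integrable_bounded_mul h.equiv.left_integrable (hqm.pow_const 2)
      (C := (s / δ * C) ^ 2) fun x => ?_
    rw [abs_pow]
    exact pow_le_pow_left₀ (abs_nonneg _) (hqb x) 2
  have hq2f : Integrable fun x => q x ^ 2 * f x :=
    h.equiv.integrable_mul h.cutoff_pos (hqt.comp₂ hqt fun a _ => a ^ 2) hq2w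
  have hqint : ∫ x, q x ^ 2 * f x ≤ s ^ 2 := by
    rw [← (h.integral_sq_weightMeasure hqt hq2f).2]
    have e : ∫ x, q x ^ 2 ∂(weightMeasure w) = (s / δ) ^ 2 * ‖v₀‖ ^ 2 := by
      rw [norm_sq_Lp_eq_integral hv₀ae, ← integral_const_mul]
      simp only [hqdef, mul_pow]
    rw [e]
    calc (s / δ) ^ 2 * ‖v₀‖ ^ 2 ≤ (s / δ) ^ 2 * δ ^ 2 := by gcongr
      _ = s ^ 2 := by field_simp
  have hqfeas : WeightFeasible m 𝒢m M f (s ^ 2 / m) q := by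
    refine ⟨hqm, hqt.1, hqt.2, hqi, hq2f, ?_⟩
    rw [one_div, inv_mul_eq_div]
    gcongr
  -- First-order optimality, applied to the pair `(K₁, K₂)`, bounds the oscillation of the bias
  -- without intercept over the class.
  have hAdiff : ∀ K₁ ∈ 𝒢m, ∀ K₂ ∈ 𝒢m,
      (linFun ψ K₁ - ∫ x, q x ∂(marginal K₁)) - (linFun ψ K₂ - ∫ x, q x ∂(marginal K₂))
        ≤ 2 * B := by
    intro K₁ k₁ K₂ k₂
    have h3 := hopt (h.toLp_mem_modulusSet k₁ k₂)
    rw [inner_Lp_eq_integral hv₀ae (MemLp.coeFn_toLp _), ← integral_const_mul] at h3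
    have h4 := h.integral_mul_binRatio_eq_sub k₁ k₂ hqt (hqi _ k₁) (hqi _ k₂)
    simp only [hqdef, mul_assoc] at h4
    rw [h4] at h3
    rw [hBdef]
    linarith
  obtain ⟨q₀, hq₀⟩ : ∃ q₀ : ℝ, worstSqBias ψ 𝒢m q₀ q ≤ ENNReal.ofReal (B ^ 2) := by
    set A := (fun H => linFun ψ H - ∫ x, q x ∂(marginal H)) '' 𝒢m with hA
    have hAne : A.Nonempty := h.nonempty.image _
    have hAb : BddAbove A := by
      refine ⟨(linFun ψ H₁ - ∫ x, q x ∂(marginal H₁)) + 2 * B, ?_⟩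
      rintro _ ⟨K, hK, rfl⟩
      linarith [hAdiff K hK H₁ h₁]
    -- This intercept centres a range of length at most `2B`.
    refine ⟨sSup A - B, iSup₂_le fun K hK => ENNReal.ofReal_le_ofReal ?_⟩
    refine sq_le_sq.2 ?_
    rw [abs_of_nonneg hB0, abs_le]
    have hle : linFun ψ K - ∫ x, q x ∂(marginal K) ≤ sSup A := le_csSup hAb ⟨K, hK, rfl⟩
    have hge : sSup A ≤ (linFun ψ K - ∫ x, q x ∂(marginal K)) + 2 * B := by
      refine csSup_le hAne ?_
      rintro _ ⟨K', hK', rfl⟩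
      linarith [hAdiff K' hK' K hK]
    constructor <;> linarith
  refine ⟨hs0, H₁, h₁, H₂, h₂, ⟨q₀, q, hqfeas, fun q₀' q' hq' => hq₀.trans (hlower q₀' q' hq')⟩, ?_⟩
  intro p₀ p hp
  have hpB : worstSqBias ψ 𝒢m p₀ p ≤ ENNReal.ofReal (B ^ 2) := (hp.2 q₀ q hqfeas).trans hq₀
  have b₁ := abs_le_of_worstSqBias_le hB0 hpB h₁
  have b₂ := abs_le_of_worstSqBias_le hB0 hpB h₂
  rw [abs_le] at b₁ b₂
  -- A minimizer has bias at most `B` at both `H₁` and `H₂`, which reverses the Cauchy–Schwarz bound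
  -- `⟨p, v₀⟩ ≤ sδ` and forces equality.
  have hge : s * δ ≤ inner ℝ ((h.memLp_weights hp.1).toLp p) v₀ := by
    rw [hinner hp.1]
    linarith [b₁.1, b₂.2]
  have heq := eq_smul_of_inner_ge hδ hs0 (h.norm_weights_le hs0 hm hp.1) hv₀ hge
  constructor
  · rw [← ae_weightMeasure_iff h.measurable_weight h.weight_pos]
    have e1 := MemLp.coeFn_toLp (h.memLp_weights hp.1)
    rw [heq] at e1
    filter_upwards [e1, Lp.coeFn_smul (s / δ) v₀, hv₀ae] with x e1 e2 e3
    rw [← e1, e2, Pi.smul_apply, e3, smul_eq_mul]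
  · intro hspos
    rw [← norm_sq_Lp_eq_integral hv₀ae]
    rw [heq, inner_smul_left, real_inner_self_eq_norm_sq] at hge
    simp only [conj_trivial] at hge
    refine le_antisymm (pow_le_pow_left₀ (norm_nonneg _) hv₀ 2) ?_
    have : s / δ * δ ^ 2 ≤ s / δ * ‖v₀‖ ^ 2 := by
      refine le_trans (le_of_eq ?_) hge
      field_simp
    exact le_of_mul_le_mul_left this (by positivity)

end RegularClass

/-! ### Consequences of a pilot close to the true density -/

section GoodPilot

variable {𝒢 : Set (Measure ℝ)} {ψ : ℝ → ℝ} {M : ℝ} {G : Measure ℝ} {f : ℝ → ℝ} {c : ℝ≥0} {η : ℝ}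

/-- The constant `4c/η` is the diameter `2c` of the localized class in the band norm, divided by the
lower bound `η/2` for the weight. -/
lemma exists_regularClass (h𝒢 : ∀ H ∈ 𝒢, IsProbabilityMeasure H) (hconv : Convex ℝ≥0 𝒢)
    (hψ : ∀ H ∈ 𝒢, Integrable ψ H) (hLbdd : BddAbove ((fun H => |linFun ψ H|) '' 𝒢))
    (hM : 0 < M) (hG : G ∈ 𝒢) (hf : Integrable f) (hη : 0 < η)
    (hlow : ∀ x ∈ Set.Icc (-M) M, η ≤ marginalDensity G x)
    (hl : η ≤ ∫ x in Set.Iic (-M), marginalDensity G x)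
    (hu : η ≤ ∫ x in Set.Ici M, marginalDensity G x)
    (hband : bandNorm M (fun x => marginalDensity G x - f x) ≤ c) (hc : c ≤ η / 2) :
    ∃ w, RegularClass ψ (localization 𝒢 M f c) M f w (4 * c / η) ∧
      ∀ x, w x ≤ 2 * marginalDensity G x := by
  have := h𝒢 _ hG
  obtain ⟨w, hwm, hwb, hwf⟩ := exists_binEquiv_weight hM (integrable_marginalDensity G)
    (continuous_marginalDensity G).measurable (marginalDensity_pos G) hf hη hlow hl hu hband hc
  have hhalf : ∀ s : Set ℝ, η ≤ ∫ x in s, marginalDensity G x → η / 2 ≤ ∫ x in s, w x := by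
    intro s hs
    have : ∫ x in s, marginalDensity G x / 2 ≤ ∫ x in s, w x :=
      integral_mono ((integrable_marginalDensity G).div_const 2).integrableOn
        hwf.left_integrable.integrableOn fun x => (hwb x).1
    rw [integral_div] at this
    linarith
  refine ⟨w, ⟨hM, fun H hH => h𝒢 _ hH.1, fun H hH => hψ _ hH.1, convex_localization h𝒢 hconv hf,
    ?_, ⟨G, hG, hband⟩, hwm, fun x => ?_, hwf, fun H₁ h₁ H₂ h₂ x => ?_⟩, fun x => (hwb x).2⟩
  · obtain ⟨B, hB⟩ := hLbdd
    exact ⟨B, fun H hH => hB ⟨H, hH.1, rfl⟩⟩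
  · have := (hwb x).1
    have := marginalDensity_pos G x
    linarith
  · have := abs_binRatio_le hM (half_pos hη) (bandNorm_sub_le_of_mem h𝒢 hf h₁ h₂) (w := w)
      (fun x hx => by linarith [(hwb x).1, hlow x hx]) (hhalf _ hl) (hhalf _ hu) x
    refine this.trans (le_of_eq ?_)
    push_cast
    field_simp
    ring

/-- The minimax weights are small compared to their standard deviation under the true marginal. -/
lemma weights_bounds {w : ℝ → ℝ} [IsProbabilityMeasure G]
    {𝒢m : Set (Measure ℝ)} {C : ℝ} (h : RegularClass ψ 𝒢m M f w C)
    (hw : ∀ x, w x ≤ 2 * marginalDensity G x) {δ s : ℝ} (hδ : 0 < δ) (hs : 0 ≤ s)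
    {H₁ H₂ : Measure ℝ} (h₁ : H₁ ∈ 𝒢m) (h₂ : H₂ ∈ 𝒢m) {q : ℝ → ℝ} (hqm : Measurable q)
    (hq : ∀ᵐ x, q x = s / δ * binRatio M w (densityDiff H₁ H₂) x)
    (hnorm : 0 < s → ∫ x, binRatio M w (densityDiff H₁ H₂) x ^ 2 ∂(weightMeasure w) = δ ^ 2)
    (e : ℝ) :
    (∀ᵐ x ∂(marginal G), |q x| ≤ s / δ * C) ∧
      s ^ 2 / 2 ≤ ∫ x, (q x - e) ^ 2 ∂(marginal G) := by
  have := h.prob _ h₁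
  have := h.prob _ h₂
  set r := binRatio M w (densityDiff H₁ H₂) with hr
  have hrm : Measurable r := h.measurable_binRatio_densityDiff h₁ h₂
  have hb : ∀ᵐ x, |q x| ≤ s / δ * C := by
    filter_upwards [hq] with x hx
    rw [hx, abs_mul, abs_of_nonneg (by positivity)]
    exact mul_le_mul_of_nonneg_left (h.bound _ h₁ _ h₂ x) (by positivity)
  have hbG : ∀ᵐ x ∂(marginal G), |q x| ≤ s / δ * C :=
    (withDensity_absolutelyContinuous _ _).ae_le hb
  refine ⟨hbG, ?_⟩
  rcases hs.eq_or_lt with h0 | hspos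
  · rw [← h0]
    refine le_trans (by norm_num) (integral_nonneg fun x => sq_nonneg _)
  have hfin := isFiniteMeasure_weightMeasure h.equiv.left_integrable
  have hqw : q =ᵐ[weightMeasure w] fun x => s / δ * r x :=
    (ae_weightMeasure_iff h.measurable_weight h.weight_pos).2 hq
  have hri : Integrable r (weightMeasure w) := (h.memLp_binRatio h₁ h₂).integrable (by norm_num)
  have hr2 : Integrable (fun x => r x ^ 2) (weightMeasure w) :=
    (h.memLp_binRatio h₁ h₂).integrable_sq
  -- Two probability densities have the same total mass. Hence under `w` the weights are centred
  -- with second moment `s²`, and subtracting any constant `e` only increases it.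
  have hr0 : ∫ x, r x ∂(weightMeasure w) = 0 := by
    have hone : TailConst M fun _ => (1 : ℝ) := ⟨⟨1, fun _ _ => rfl⟩, 1, fun _ _ => rfl⟩
    have := integral_mul_binRatio h.cutoff_pos h.measurable_weight h.equiv.left_integrable
      h.weight_pos (integrable_densityDiff H₁ H₂) hone
      (by simpa using integrable_densityDiff H₁ H₂)
    simpa [integral_densityDiff] using this
  have hlow : s ^ 2 ≤ ∫ x, (q x - e) ^ 2 ∂(weightMeasure w) := by
    have e1 : ∫ x, (q x - e) ^ 2 ∂(weightMeasure w)
        = ∫ x, ((s / δ) ^ 2 * r x ^ 2 - 2 * e * (s / δ) * r x + e ^ 2) ∂(weightMeasure w) := by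
      refine integral_congr_ae ?_
      filter_upwards [hqw] with x hx
      rw [hx]; ring
    have i1 := hr2.const_mul ((s / δ) ^ 2)
    have i2 := hri.const_mul (2 * e * (s / δ))
    have i3 : Integrable (fun x => (s / δ) ^ 2 * r x ^ 2 - 2 * e * (s / δ) * r x)
      (weightMeasure w) := i1.sub i2
    rw [e1, integral_add i3 (integrable_const _), integral_sub i1 i2, integral_const_mul,
      integral_const_mul, hnorm hspos, hr0]
    have : 0 ≤ ∫ _, e ^ 2 ∂(weightMeasure w) := integral_nonneg fun _ => sq_nonneg e
    have e2 : (s / δ) ^ 2 * δ ^ 2 = s ^ 2 := by field_simp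
    linarith
  have hsm : Measurable fun x => (q x - e) ^ 2 := (hqm.sub_const e).pow_const 2
  have hsb : ∀ᵐ x, ‖(q x - e) ^ 2‖ ≤ (s / δ * C + |e|) ^ 2 := by
    filter_upwards [hb] with x hx
    rw [Real.norm_eq_abs, abs_pow]
    exact pow_le_pow_left₀ (abs_nonneg _) ((abs_sub _ _).trans (by linarith)) 2
  rw [integral_marginal]
  rw [weightMeasure, integral_withDensity_ofReal h.measurable_weight
    (fun x => (h.weight_pos x).le)] at hlow
  have i1 : Integrable fun x => (q x - e) ^ 2 * w x :=
    h.equiv.left_integrable.bdd_mul hsm.aestronglyMeasurable hsb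
  have i2 : Integrable fun x => (q x - e) ^ 2 * marginalDensity G x :=
    (integrable_marginalDensity G).bdd_mul hsm.aestronglyMeasurable hsb
  have hmono : ∫ x, (q x - e) ^ 2 * w x ≤ ∫ x, 2 * ((q x - e) ^ 2 * marginalDensity G x) := by
    refine integral_mono i1 (i2.const_mul 2) fun x => ?_
    have := mul_le_mul_of_nonneg_left (hw x) (sq_nonneg (q x - e))
    simp only
    linarith
  rw [integral_const_mul] at hmono
  linarith

end GoodPilot

/-! ### From the interval to the quantile event -/

section Miss

/-- The case of zero supergradient, where nothing can be standardized: almost surely both sides of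
the defining inequality equal `|b|`, so the Gaussian probability is `1`. -/
lemma measure_quantileMiss_eq_zero_of_ae_zero (μ : Measure ℝ) [IsProbabilityMeasure μ] {α : ℝ≥0∞}
    (hα : α ≤ 1) {q : ℝ → ℝ} (hq : ∀ᵐ x ∂μ, q x = 0) (m : ℕ) (b : ℝ) :
    (Measure.pi fun _ : Fin m => μ) (quantileMiss α m q 0 b) = 0 := by
  have hall : ∀ᵐ x ∂(Measure.pi fun _ : Fin m => μ), ∀ i, q (x i) = 0 :=
    ae_all_iff.2 fun i => (measurePreserving_eval (fun _ : Fin m => μ) i).quasiMeasurePreserving.ae hq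
  refine measure_eq_zero_iff_ae_notMem.2 ?_
  filter_upwards [hall] with x hx hmem
  have hmem' : gaussianReal 0 1 {z : ℝ | |b + ((1 / (m : ℝ)) * ∑ i, q (x i) - 0)|
    ≤ |b + √(sampleVariance m q x) * z|} < α := hmem
  simp [hx, sampleVariance] at hmem'
  exact absurd hmem' (not_lt.2 hα)

/-- Non-coverage of the bias-aware interval implies non-coverage of the quantile interval for the
actual bias. -/
lemma mem_quantileMiss_of_notMem_interval {α : ℝ} {m : ℕ} {ψ : ℝ → ℝ} {𝒢m : Set (Measure ℝ)}
    {Q₀ : ℝ} {Q : ℝ → ℝ} {x : Fin m → ℝ} {G : Measure ℝ} (hG : G ∈ 𝒢m)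
    (h : linFun ψ G ∉ biasAwareInterval α m ψ 𝒢m Q₀ Q x) :
    x ∈ quantileMiss (ENNReal.ofReal α) m Q (∫ y, Q y ∂(marginal G))
      (Q₀ + (∫ y, Q y ∂(marginal G)) - linFun ψ G) := by
  set b := Q₀ + (∫ y, Q y ∂(marginal G)) - linFun ψ G with hb
  have hbias : ENNReal.ofReal |b| ≤ worstBias ψ 𝒢m Q₀ Q := by
    have h1 : ENNReal.ofReal (b ^ 2) ≤ worstSqBias ψ 𝒢m Q₀ Q :=
      le_iSup₂ (f := fun H (_ : H ∈ 𝒢m) =>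
        ENNReal.ofReal ((Q₀ + (∫ x, Q x ∂(marginal H)) - linFun ψ H) ^ 2)) G hG
    have h2 : ENNReal.ofReal |b| = ENNReal.ofReal (b ^ 2) ^ (1 / 2 : ℝ) := by
      rw [ENNReal.ofReal_rpow_of_nonneg (sq_nonneg b) (by norm_num), ← Real.sqrt_eq_rpow,
        Real.sqrt_sq_eq_abs]
    rw [h2]
    exact ENNReal.rpow_le_rpow h1 (by norm_num)
  have hlt : criticalValue α (worstBias ψ 𝒢m Q₀ Q) (sampleVariance m Q x)
      < ENNReal.ofReal |estimator m Q₀ Q x - linFun ψ G| := not_le.1 h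
  -- Some admissible `t` lies strictly below the actual error, so `|b + √V̂ z|` exceeds `t` whenever
  -- it reaches that error. This works whether or not the infimum is attained.
  obtain ⟨t, ht, htlt⟩ := sInf_lt_iff.1 hlt
  refine lt_of_le_of_lt (measure_mono fun z hz => ?_) (ht b hbias)
  have hz' : |b + ((1 / (m : ℝ)) * ∑ i, Q (x i) - ∫ y, Q y ∂(marginal G))|
    ≤ |b + √(sampleVariance m Q x) * z| := hz
  have e : estimator m Q₀ Q x - linFun ψ G
      = b + ((1 / (m : ℝ)) * ∑ i, Q (x i) - ∫ y, Q y ∂(marginal G)) := by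
    rw [hb, estimator]; ring
  rw [e] at htlt
  exact htlt.trans_le (ENNReal.ofReal_le_ofReal hz')

end Miss

/-! ### Coverage given a good first fold -/

section ConditionalCoverage

/-- Conditionally on a first fold with good properties, the miss probability is controlled. -/
lemma exists_conditional_miss_le {𝒢 : Set (Measure ℝ)} {ψ : ℝ → ℝ} {M : ℝ} {G : Measure ℝ}
    (h𝒢 : ∀ H ∈ 𝒢, IsProbabilityMeasure H) (hconv : Convex ℝ≥0 𝒢)
    (hψ : ∀ H ∈ 𝒢, Integrable ψ H) (hLbdd : BddAbove ((fun H => |linFun ψ H|) '' 𝒢))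
    (hM : 0 < M) (hG : G ∈ 𝒢) {α : ℝ≥0∞} (hα : α ≤ 1) {ε : ℝ} (hε : 0 < ε) :
    ∃ κ > 0, ∃ m₀ : ℕ, ∀ m ≥ m₀, ∀ (f : ℝ → ℝ) (c : ℝ≥0) (δ Γ Q₀ : ℝ) (Q : ℝ → ℝ),
      Integrable f → 0 < δ →
      ((superdifferential (modulus ψ (localization 𝒢 M f c) M f) δ).Nonempty →
        ∃ s ∈ superdifferential (modulus ψ (localization 𝒢 M f c) M f) δ, Γ = s ^ 2 / (m : ℝ)) →
      Measurable Q →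
      ((∃ q₀ q, IsMinimax m ψ (localization 𝒢 M f c) M f Γ q₀ q) →
        IsMinimax m ψ (localization 𝒢 M f c) M f Γ Q₀ Q) →
      bandNorm M (fun x => marginalDensity G x - f x) ≤ c →
      (c : ℝ) ≤ κ → (c : ℝ) ^ 2 / (m * δ ^ 2) ≤ κ →
      ModulusAttained ψ (localization 𝒢 M f c) M f δ →
      (Measure.pi fun _ : Fin m => marginal G) (quantileMiss α m Q (∫ y, Q y ∂(marginal G))
        (Q₀ + (∫ y, Q y ∂(marginal G)) - linFun ψ G)) ≤ α + ENNReal.ofReal ε := by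
  have := h𝒢 _ hG
  obtain ⟨η, hη, hlow, hl, hu⟩ := exists_marginalDensity_lower_bound G hM
  obtain ⟨κ, hκ, m₀, hmain⟩ := exists_measure_quantileMiss_le (marginal G) α hε
  -- The first bound makes the pilot comparable to `f_G`. With `|Q| ≤ 4sc/(δη)`, the squared bound
  -- `64 s²c²/(δ²η²)` for `|Q - e|` must stay below `κ m s²/2`, whence the factor `128`.
  refine ⟨min (η / 2) (κ * η ^ 2 / 128), lt_min (by positivity) (by positivity), max m₀ 1, ?_⟩
  intro m hm f c δ Γ Q₀ Q hf hδ hΓ hQm hsol hband hc hcδ hatt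
  have hm0 : 0 < m := (le_max_right _ _).trans hm
  have hm' : (0 : ℝ) < m := by exact_mod_cast hm0
  obtain ⟨w, hreg, hw⟩ := exists_regularClass h𝒢 hconv hψ hLbdd hM hG hf hη hlow hl hu hband
    (hc.trans (min_le_left _ _))
  obtain ⟨s, hs, rfl⟩ := hΓ (hreg.superdifferential_modulus_nonempty hδ)
  obtain ⟨hs0, H₁, h₁, H₂, h₂, hex, hform⟩ := hreg.minimax_of_attained hδ hs hm0 hatt
  obtain ⟨hQ, hnorm⟩ := hform Q₀ Q (hsol hex)
  set e := ∫ y, Q y ∂(marginal G) with he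
  obtain ⟨hb, hvar⟩ := weights_bounds hreg hw hδ hs0 h₁ h₂ hQm hQ hnorm e
  set A := s / δ * (4 * c / η) with hA
  have hA0 : 0 ≤ A := by positivity
  have hbi : Integrable Q (marginal G) := Integrable.of_bound hQm.aestronglyMeasurable A
    (by simpa using hb)
  rcases hs0.eq_or_lt with h0 | hspos
  · have hz : ∀ᵐ x ∂(marginal G), Q x = 0 := by
      filter_upwards [hb] with x hx
      rw [hA, ← h0, zero_div, zero_mul] at hx
      exact abs_nonpos_iff.1 hx
    have he0 : e = 0 := by rw [he, integral_congr_ae hz, integral_zero]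
    rw [he0, measure_quantileMiss_eq_zero_of_ae_zero (marginal G) hα hz]
    exact zero_le
  · have heb : |e| ≤ A := by
      have := norm_integral_le_of_norm_le_const (μ := marginal G) (f := Q) (C := A)
        (by simpa using hb)
      simpa using this
    have hvpos : 0 < ∫ x, (Q x - e) ^ 2 ∂(marginal G) :=
      lt_of_lt_of_le (by positivity) hvar
    refine hmain m ((le_max_left _ _).trans hm) Q (2 * A) e _
      (√(∫ x, (Q x - e) ^ 2 ∂(marginal G))) hQm (Real.sqrt_pos.2 hvpos) ?_
      (Real.sq_sqrt hvpos.le).symm ?_ ?_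
    · rw [integral_sub hbi (integrable_const _)]
      simp [he]
    · filter_upwards [hb] with x hx
      exact (abs_sub _ _).trans (by linarith)
    · rw [Real.sq_sqrt hvpos.le]
      have h1 : (c : ℝ) ^ 2 ≤ κ * η ^ 2 / 128 * (m * δ ^ 2) := by
        have := hcδ.trans (min_le_right _ _)
        rwa [div_le_iff₀ (by positivity)] at this
      calc (2 * A) ^ 2 = 64 * s ^ 2 / (δ ^ 2 * η ^ 2) * (c : ℝ) ^ 2 := by
            rw [hA]; field_simp; ring
        _ ≤ 64 * s ^ 2 / (δ ^ 2 * η ^ 2) * (κ * η ^ 2 / 128 * (m * δ ^ 2)) := by gcongr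
        _ = κ * (m * (s ^ 2 / 2)) := by field_simp; ring
        _ ≤ _ := by gcongr

end ConditionalCoverage

/-! ### Independence of the folds and Fubini -/

section TwoFolds

lemma measurable_quantileMiss_uncurry (α : ℝ≥0∞) (m : ℕ) {S : Type*} [MeasurableSpace S]
    {q : S → ℝ → ℝ} (hq : Measurable (Function.uncurry q)) {e b : S → ℝ} (he : Measurable e)
    (hb : Measurable b) :
    MeasurableSet {p : S × (Fin m → ℝ) | p.2 ∈ quantileMiss α m (q p.1) (e p.1) (b p.1)} := by
  have hqi : ∀ i : Fin m, Measurable fun p : S × (Fin m → ℝ) => q p.1 (p.2 i) := fun i =>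
    hq.comp (measurable_fst.prodMk ((measurable_pi_apply i).comp measurable_snd))
  have hsv : Measurable fun p : S × (Fin m → ℝ) => sampleVariance m (q p.1) p.2 := by
    unfold sampleVariance
    fun_prop
  have hset : MeasurableSet {t : (S × (Fin m → ℝ)) × ℝ |
      |b t.1.1 + ((1 / (m : ℝ)) * ∑ i, q t.1.1 (t.1.2 i) - e t.1.1)|
        ≤ |b t.1.1 + √(sampleVariance m (q t.1.1) t.1.2) * t.2|} := by
    have h1 : Measurable fun t : (S × (Fin m → ℝ)) × ℝ => √(sampleVariance m (q t.1.1) t.1.2) :=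
      (hsv.comp measurable_fst).sqrt
    have h2 : Measurable fun t : (S × (Fin m → ℝ)) × ℝ => ∑ i, q t.1.1 (t.1.2 i) :=
      Finset.measurable_sum _ fun i _ => (hqi i).comp measurable_fst
    have h3 : Measurable fun t : (S × (Fin m → ℝ)) × ℝ => b t.1.1 :=
      hb.comp (measurable_fst.comp measurable_fst)
    have h4 : Measurable fun t : (S × (Fin m → ℝ)) × ℝ => e t.1.1 :=
      he.comp (measurable_fst.comp measurable_fst)
    refine measurableSet_le ?_ ?_
    · exact (h3.add ((h2.const_mul _).sub h4)).abs
    · exact (h3.add (h1.mul measurable_snd)).abs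
  exact measurableSet_lt (measurable_measure_prodMk_left (ν := gaussianReal 0 1) hset)
    measurable_const

/-- Good first folds are described by the size of the section of `N`, which is measurable in the
first coordinate. Thus the localization and attainment events need not be measurable. -/
lemma measure_mem_and_section_le {Ω S T : Type*} [MeasurableSpace Ω] [MeasurableSpace S] [MeasurableSpace T]
    {P : Measure Ω} {μ : Measure S} [IsProbabilityMeasure μ] {ν : Measure T} [IsProbabilityMeasure ν]
    {U : Ω → S × T} (hU : HasLaw U (μ.prod ν) P) {N : Set (S × T)} (hN : MeasurableSet N)
    (a : ℝ≥0∞) : P {ω | U ω ∈ N ∧ ν (Prod.mk (U ω).1 ⁻¹' N) ≤ a} ≤ a := by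
  have hsec : MeasurableSet {s : S | ν (Prod.mk s ⁻¹' N) ≤ a} :=
    measurableSet_le (measurable_measure_prodMk_left hN) measurable_const
  have hset : MeasurableSet {p : S × T | p ∈ N ∧ ν (Prod.mk p.1 ⁻¹' N) ≤ a} :=
    hN.inter (measurable_fst hsec)
  rw [hU.measure_eq hset, Measure.prod_apply hset]
  calc ∫⁻ s, ν (Prod.mk s ⁻¹' {p : S × T | p ∈ N ∧ ν (Prod.mk p.1 ⁻¹' N) ≤ a}) ∂μ
      ≤ ∫⁻ _, a ∂μ := by
        refine lintegral_mono fun s => ?_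
        by_cases hs : ν (Prod.mk s ⁻¹' N) ≤ a
        · exact (measure_mono fun t ht => ht.1).trans hs
        · have : Prod.mk s ⁻¹' {p : S × T | p ∈ N ∧ ν (Prod.mk p.1 ⁻¹' N) ≤ a} = ∅ :=
            Set.eq_empty_of_forall_notMem fun t ht => hs ht.2
          rw [this, measure_empty]
          exact zero_le
    _ = a := by simp

variable {Ω : Type*} [MeasurableSpace Ω] {P : Measure Ω} [IsProbabilityMeasure P]

lemma hasLaw_folds {μ : Measure ℝ} [IsProbabilityMeasure μ] {Xt X : ℕ → Ω → ℝ}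
    (hXt : ∀ i, HasLaw (Xt i) μ P) (hX : ∀ i, HasLaw (X i) μ P)
    (hindep : iIndepFun (fun i : ℕ ⊕ ℕ => Sum.elim Xt X i) P) (m : ℕ) :
    HasLaw (fun ω => (firstObs Xt m ω, firstObs X m ω))
      ((Measure.pi fun _ : Fin m => μ).prod (Measure.pi fun _ : Fin m => μ)) P := by
  have hlaw : ∀ i, HasLaw (Sum.elim Xt X i) μ P := fun i => by
    cases i with
    | inl i => exact hXt i
    | inr i => exact hX i
  have hxt : AEMeasurable (firstObs Xt m) P := aemeasurable_pi_lambda _ fun i =>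
    (hXt i).aemeasurable
  have hx : AEMeasurable (firstObs X m) P := aemeasurable_pi_lambda _ fun i =>
    (hX i).aemeasurable
  have hlt : P.map (firstObs Xt m) = Measure.pi fun _ : Fin m => μ := by
    have h := hindep.precomp (g := fun i : Fin m => (Sum.inl (i : ℕ) : ℕ ⊕ ℕ))
      (fun i j h => Fin.ext (Sum.inl_injective h))
    have := (iIndepFun_iff_map_fun_eq_pi_map fun i => (hlaw _).aemeasurable).1 h
    simp only [(hlaw _).map_eq] at this
    exact this
  have hl : P.map (firstObs X m) = Measure.pi fun _ : Fin m => μ := by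
    have h := hindep.precomp (g := fun i : Fin m => (Sum.inr (i : ℕ) : ℕ ⊕ ℕ))
      (fun i j h => Fin.ext (Sum.inr_injective h))
    have := (iIndepFun_iff_map_fun_eq_pi_map fun i => (hlaw _).aemeasurable).1 h
    simp only [(hlaw _).map_eq] at this
    exact this
  have hind : IndepFun (firstObs Xt m) (firstObs X m) P := by
    have h := hindep.indepFun_finset₀ ((Finset.range m).map ⟨Sum.inl, Sum.inl_injective⟩)
      ((Finset.range m).map ⟨Sum.inr, Sum.inr_injective⟩)
      (by
        rw [Finset.disjoint_left]
        intro a ha hb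
        obtain ⟨i, -, rfl⟩ := Finset.mem_map.1 ha
        obtain ⟨j, -, hj⟩ := Finset.mem_map.1 hb
        exact absurd hj Sum.inr_ne_inl)
      (fun i => (hlaw i).aemeasurable)
    exact h.comp (φ := fun x (i : Fin m) => x ⟨Sum.inl (i : ℕ), by simp⟩)
      (ψ := fun x (i : Fin m) => x ⟨Sum.inr (i : ℕ), by simp⟩) 
      (measurable_pi_lambda _ fun _ => measurable_pi_apply _)
      (measurable_pi_lambda _ fun _ => measurable_pi_apply _)
  refine ⟨hxt.prodMk hx, ?_⟩
  rw [(indepFun_iff_map_prod_eq_prod_map_map hxt hx).1 hind, hlt, hl]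

end TwoFolds

end BiasAware

/-! ### Assembly of the coverage theorem -/

theorem mainTheorem3
    -- the class of effect size distributions, the functional, the tail cutoff, the level
    (𝒢 : Set (Measure ℝ)) (h𝒢prob : ∀ H ∈ 𝒢, IsProbabilityMeasure H) (h𝒢conv : Convex ℝ≥0 𝒢)
    (ψ : ℝ → ℝ) (hψint : ∀ H ∈ 𝒢, Integrable ψ H)
    (hLbdd : BddAbove ((fun H => |BiasAware.linFun ψ H|) '' 𝒢))
    (M : ℝ) (hM : 0 < M) (α : ℝ) (hα0 : 0 < α) (hα1 : α < 1)
    -- the true effect size distribution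
    (G : Measure ℝ) (hG : G ∈ 𝒢)
    -- the two folds: independent observations with density `f_G`
    {Ω : Type*} [MeasurableSpace Ω] (P : Measure Ω) [IsProbabilityMeasure P]
    (Xt X : ℕ → Ω → ℝ)
    (hXt : ∀ i, HasLaw (Xt i) (BiasAware.marginal G) P)
    (hX : ∀ i, HasLaw (X i) (BiasAware.marginal G) P)
    (hindep : iIndepFun (fun i : ℕ ⊕ ℕ => Sum.elim Xt X i) P)
    -- the choices made from the first fold: pilot density, localization radius, `δ_m`, `Γ_m`
    (fbar : (m : ℕ) → (Fin m → ℝ) → ℝ → ℝ) (hfbar : ∀ m xt, Integrable (fbar m xt))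
    (c : (m : ℕ) → (Fin m → ℝ) → ℝ≥0)
    (δ : (m : ℕ) → (Fin m → ℝ) → ℝ) (hδ : ∀ m xt, 0 < δ m xt)
    (Γ : (m : ℕ) → (Fin m → ℝ) → ℝ)
    -- `Γ_m = m⁻¹ ω_m'(δ_m)²` with `ω_m'(δ_m)` an element of the superdifferential
    (hΓ : ∀ m xt,
      (BiasAware.superdifferential
        (BiasAware.modulus ψ (BiasAware.localization 𝒢 M (fbar m xt) (c m xt)) M (fbar m xt))
        (δ m xt)).Nonempty →
      ∃ s ∈ BiasAware.superdifferential
        (BiasAware.modulus ψ (BiasAware.localization 𝒢 M (fbar m xt) (c m xt)) M (fbar m xt))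
        (δ m xt), Γ m xt = s ^ 2 / (m : ℝ))
    -- the weights, computed from the first fold: a solution of the minimax problem if there is one
    (Q₀ : (m : ℕ) → (Fin m → ℝ) → ℝ) (hQ₀ : ∀ m, Measurable (Q₀ m))
    (Q : (m : ℕ) → (Fin m → ℝ) → ℝ → ℝ) (hQ : ∀ m, Measurable (Function.uncurry (Q m)))
    (hsol : ∀ m xt,
      (∃ q₀ q, BiasAware.IsMinimax m ψ (BiasAware.localization 𝒢 M (fbar m xt) (c m xt)) M
        (fbar m xt) (Γ m xt) q₀ q) →
      BiasAware.IsMinimax m ψ (BiasAware.localization 𝒢 M (fbar m xt) (c m xt)) M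
        (fbar m xt) (Γ m xt) (Q₀ m xt) (Q m xt))
    -- `P(‖f_G - f̄_m‖_{∞,M} ≤ c_m) → 1`
    (hband : BiasAware.TendstoProbOne P fun m => {ω |
      BiasAware.bandNorm M (fun x => BiasAware.marginalDensity G x
        - fbar m (BiasAware.firstObs Xt m ω) x) ≤ (c m (BiasAware.firstObs Xt m ω) : ℝ≥0∞)})
    -- `c_m → 0` and `c_m² / (m δ_m²) → 0` in probability
    (hc : TendstoInMeasure P
      (fun m ω => (c m (BiasAware.firstObs Xt m ω) : ℝ)) atTop (fun _ => (0 : ℝ)))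
    (hcδ : TendstoInMeasure P
      (fun m ω => (c m (BiasAware.firstObs Xt m ω) : ℝ) ^ 2
        / ((m : ℝ) * δ m (BiasAware.firstObs Xt m ω) ^ 2)) atTop (fun _ => (0 : ℝ)))
    -- the modulus problem at `δ_m` has a solution, with probability tending to one
    (hattained : BiasAware.TendstoProbOne P fun m => {ω |
      BiasAware.ModulusAttained ψ
        (BiasAware.localization 𝒢 M (fbar m (BiasAware.firstObs Xt m ω))
          (c m (BiasAware.firstObs Xt m ω))) M
        (fbar m (BiasAware.firstObs Xt m ω)) (δ m (BiasAware.firstObs Xt m ω))}) :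
    ENNReal.ofReal (1 - α) ≤ liminf (fun m => P {ω |
        BiasAware.linFun ψ G ∈ BiasAware.biasAwareInterval α m ψ
          (BiasAware.localization 𝒢 M (fbar m (BiasAware.firstObs Xt m ω))
            (c m (BiasAware.firstObs Xt m ω)))
          (Q₀ m (BiasAware.firstObs Xt m ω)) (Q m (BiasAware.firstObs Xt m ω))
          (BiasAware.firstObs X m ω)}) atTop ∧
    -- the same in terms of non-coverage, which is the stronger form if coverage is not known to be
    -- a measurable event
    limsup (fun m => P {ω |
        BiasAware.linFun ψ G ∉ BiasAware.biasAwareInterval α m ψ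
          (BiasAware.localization 𝒢 M (fbar m (BiasAware.firstObs Xt m ω))
            (c m (BiasAware.firstObs Xt m ω)))
          (Q₀ m (BiasAware.firstObs Xt m ω)) (Q m (BiasAware.firstObs Xt m ω))
          (BiasAware.firstObs X m ω)}) atTop ≤ ENNReal.ofReal α := by
  have hGp := h𝒢prob _ hG
  set A : ℕ → Set Ω := fun m => {ω |
        BiasAware.linFun ψ G ∉ BiasAware.biasAwareInterval α m ψ
          (BiasAware.localization 𝒢 M (fbar m (BiasAware.firstObs Xt m ω))
            (c m (BiasAware.firstObs Xt m ω)))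
          (Q₀ m (BiasAware.firstObs Xt m ω)) (Q m (BiasAware.firstObs Xt m ω))
          (BiasAware.firstObs X m ω)} with hA
  have hlimsup : limsup (fun m => P (A m)) atTop ≤ ENNReal.ofReal α := by
    refine ENNReal.le_of_forall_pos_le_add fun ε hε _ => ?_
    obtain ⟨κ, hκ, m₀, hcond⟩ := BiasAware.exists_conditional_miss_le h𝒢prob h𝒢conv hψint hLbdd hM
      hG (ENNReal.ofReal_le_one.2 hα1.le) (NNReal.coe_pos.2 hε)
    rw [tendstoInMeasure_iff_dist] at hc hcδ
    -- The bounds on first folds that violate one of the four conditions; their sum tends to zero.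
    have hbad := ((hband.add hattained).add (hc κ hκ)).add (hcδ κ hκ)
    simp only [add_zero] at hbad
    have hlim := hbad.const_add (ENNReal.ofReal α + ε)
    rw [add_zero] at hlim
    rw [← hlim.limsup_eq]
    refine limsup_le_limsup ?_
    filter_upwards [eventually_ge_atTop m₀] with m hm
    set e : (Fin m → ℝ) → ℝ := fun xt => ∫ y, Q m xt y ∂(BiasAware.marginal G) with he
    set b : (Fin m → ℝ) → ℝ := fun xt => Q₀ m xt + e xt - BiasAware.linFun ψ G with hb
    -- A measurable set that contains the miss event whenever `G` is in the localized class; the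
    -- miss event itself involves a supremum over that class and need not be measurable.
    set N : Set ((Fin m → ℝ) × (Fin m → ℝ)) := {p | p.2 ∈ BiasAware.quantileMiss
      (ENNReal.ofReal α) m (Q m p.1) (e p.1) (b p.1)} with hN
    have hem : Measurable e := (hQ m).stronglyMeasurable.integral_prod_right.measurable
    have hNm : MeasurableSet N := BiasAware.measurable_quantileMiss_uncurry _ m (hQ m) hem
      (((hQ₀ m).add hem).sub_const _)
    have hmain := BiasAware.measure_mem_and_section_le (BiasAware.hasLaw_folds hXt hX hindep m)
      hNm (ENNReal.ofReal α + ε)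
    have hsub : A m ⊆ {ω | (BiasAware.firstObs Xt m ω, BiasAware.firstObs X m ω) ∈ N ∧
        (Measure.pi fun _ : Fin m => BiasAware.marginal G)
          (Prod.mk (BiasAware.firstObs Xt m ω) ⁻¹' N) ≤ ENNReal.ofReal α + ε}
        ∪ ((({ω | BiasAware.bandNorm M (fun x => BiasAware.marginalDensity G x
          - fbar m (BiasAware.firstObs Xt m ω) x)
            ≤ (c m (BiasAware.firstObs Xt m ω) : ℝ≥0∞)}ᶜ
          ∪ {ω | BiasAware.ModulusAttained ψ
            (BiasAware.localization 𝒢 M (fbar m (BiasAware.firstObs Xt m ω))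
              (c m (BiasAware.firstObs Xt m ω))) M
            (fbar m (BiasAware.firstObs Xt m ω)) (δ m (BiasAware.firstObs Xt m ω))}ᶜ)
          ∪ {ω | κ ≤ dist (c m (BiasAware.firstObs Xt m ω) : ℝ) 0})
          ∪ {ω | κ ≤ dist ((c m (BiasAware.firstObs Xt m ω) : ℝ) ^ 2
            / ((m : ℝ) * δ m (BiasAware.firstObs Xt m ω) ^ 2)) 0}) := by
      intro ω hω
      by_contra hnot
      simp only [Set.mem_union, Set.mem_compl_iff, not_or, not_not] at hnot
      obtain ⟨h1, ⟨⟨h2, h3⟩, h4⟩, h5⟩ := hnot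
      set xt := BiasAware.firstObs Xt m ω with hxt
      have h4' : (c m xt : ℝ) ≤ κ := by
        have : ¬ κ ≤ dist (c m xt : ℝ) 0 := h4
        rw [Real.dist_0_eq_abs, abs_of_nonneg (c m xt).coe_nonneg, not_le] at this
        exact this.le
      have h5' : (c m xt : ℝ) ^ 2 / ((m : ℝ) * δ m xt ^ 2) ≤ κ := by
        have : ¬ κ ≤ dist ((c m xt : ℝ) ^ 2 / ((m : ℝ) * δ m xt ^ 2)) 0 := h5
        rw [Real.dist_0_eq_abs, abs_of_nonneg (by positivity), not_le] at this
        exact this.le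
      have hle := hcond m hm (fbar m xt) (c m xt) (δ m xt) (Γ m xt) (Q₀ m xt) (Q m xt)
        (hfbar m xt) (hδ m xt) (hΓ m xt) ((hQ m).comp measurable_prodMk_left) (hsol m xt) h2 h4'
        h5' h3
      rw [ENNReal.ofReal_coe_nnreal] at hle
      have hGm : G ∈ BiasAware.localization 𝒢 M (fbar m xt) (c m xt) := ⟨hG, h2⟩
      exact h1 ⟨BiasAware.mem_quantileMiss_of_notMem_interval hGm hω, hle⟩
    refine (measure_mono hsub).trans ((measure_union_le _ _).trans (add_le_add hmain ?_))
    refine (measure_union_le _ _).trans (add_le_add ?_ le_rfl)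
    refine (measure_union_le _ _).trans (add_le_add ?_ le_rfl)
    exact measure_union_le _ _
  refine ⟨?_, hlimsup⟩
  -- Subadditivity suffices in this direction, so measurability of the coverage event is not
  -- required.
  have hcov : ∀ m, 1 - P (A m) ≤ P (A m)ᶜ := fun m => by
    rw [tsub_le_iff_left, ← measure_univ (μ := P), ← Set.union_compl_self (A m)]
    exact measure_union_le _ _
  calc ENNReal.ofReal (1 - α) = 1 - ENNReal.ofReal α := by
        rw [ENNReal.ofReal_sub _ hα0.le, ENNReal.ofReal_one]
    _ ≤ 1 - limsup (fun m => P (A m)) atTop := tsub_le_tsub_left hlimsup _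
    _ = liminf (fun m => 1 - P (A m)) atTop :=
        (ENNReal.liminf_const_sub atTop (fun m => P (A m)) ENNReal.one_ne_top).symm
    _ ≤ liminf (fun m => P (A m)ᶜ) atTop := liminf_le_liminf (Eventually.of_forall hcov)
    _ = _ := by
        congr 1
        ext m
        congr 1
        ext ω
        simp [hA]
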